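/- Let $(\Omega,\mathcal F,P)$ be a probability space and let $(\mathcal F_t)_{t\in\mathcal T}$ be a filtration of $\mathcal F$, where $\mathcal T$ is a totally ordered set of times with least element $0$ and greatest element $T$ (in particular $\mathcal T=[0,T]$ or $\mathcal T=\{0,1,\dots,T\}$), $\mathcal F_0=\{\emptyset,\Omega\}$ and $\mathcal F_T=\mathcal F$. Write $L^\infty=L^\infty(\Omega,\mathcal F,P)$, and let $L^\infty(\mathcal F_t)\subseteq L^\infty$ be the subspace of the (classes of) $\mathcal F_t$-measurable essentially bounded random variables; equalities, inequalities and limits of random variables are understood $P$-a.s. Let $(\rho_t)_{t\in\mathcal T}$ be a family of maps $\rho_t:L^\infty\to L^\infty(\mathcal F_t)$ such that, for all $t\in\mathcal T$ and $X,Y\in L^\infty$: - (convexity) $\rho_t(\alpha X+(1-\alpha)Y)\le \alpha\rho_t(X)+(1-\alpha)\rho_t(Y)$ for all $\alpha\in[0,1]$; - (monotonicity) $X\le Y$ implies $\rho_t(X)\ge\rho_t(Y)$; - (cash-subadditivity) $\rho_t(X+m_t)\ge\rho_t(X)-m_t$ for all $m_t\in L^\infty(\mathcal F_t)$ with $m_t\ge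 0$; - (normalization) $\rho_t(0)=0$; - (regularity) $\rho_t(X1_A+Y1_{A^c})=1_A\rho_t(X)+1_{A^c}\rho_t(Y)$ for all $A\in\mathcal F_t$. Let $\mathcal D$ be the set of all $(\mathcal F_t)$-adapted processes $D=(D_t)_{t\in\mathcal T}$ with values in $[0,1]$, and let $\mathcal Q_t$ be the set of all probability measures $Q$ on $(\Omega,\mathcal F)$ with $Q\ll P$ and $Q=P$ on $\mathcal F_t$. A penalty term at time $t$ is a map $c_t$ that assigns to each $(D,Q)\in\mathcal D\times\mathcal Q_t$ an $\mathcal F_t$-measurable random variable $c_t(DQ)$ with values in $[0,+\infty]$. The essential supremum of a family of $[-\infty,+\infty]$-valued random variables is the $P$-a.s. smallest random variable that is $P$-a.s. greater than or equal to each member of the family. Then the following are equivalent: 1. For every $t\in\mathcal T$, $\rho_t$ is continuous from above: if $X_n,X\in L^\infty$ and $X_n\downarrow X$ $P$-a.s., then $\rho_t(X_n)\to\rho_t(X)$ $P$-a.s. 2. For every $t\in\mathcal T$ there is a penalty term $c_t$ such that, for all $X\in L^\infty$, $$\rho_t(X)=\operatorname*{ess\,sup}_{(D,Q)\in\mathcal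 D\times\mathcal Q_t}\bigl\{D_t\,E_Q[-X\mid\mathcal F_t]-c_t(DQ)\bigr\}.\qquad(*)$$ 3. For every $t\in\mathcal T$, the formula $$\bar c_t(DQ)=\operatorname*{ess\,sup}_{X\in L^\infty}\bigl\{D_t\,E_Q[-X\mid\mathcal F_t]-\rho_t(X)\bigr\},\qquad (D,Q)\in\mathcal D\times\mathcal Q_t,$$ defines (up to $P$-a.s. equality) a penalty term $\bar c_t$ at time $t$, and $(*)$ holds for all $X\in L^\infty$ with $c_t=\bar c_t$. -/

import Mathlib

open MeasureTheory Filter Topology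
open scoped ENNReal

namespace DynRisk

variable {Ω : Type*} {m : MeasurableSpace Ω} {τ : Type*} [Preorder τ]

/-- The space `L^∞(F_t)`, as a subspace of `L^∞ = L^∞(Ω, F, P)`: the classes of essentially bounded
random variables that have an `F_t`-measurable representative. -/
noncomputable abbrev LInfty (P : Measure Ω) (ℱ : Filtration τ m) (t : τ) : Submodule ℝ (Lp ℝ ∞ P) :=
  lpMeas ℝ ℝ (ℱ t) ∞ P

/-- A family of maps `ρ_t : L^∞ → L^∞(F_t)`, one for each time. -/
abbrev RiskFamily (P : Measure Ω) (ℱ : Filtration τ m) : Type _ :=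
  ∀ t : τ, Lp ℝ ∞ P → LInfty P ℱ t

/-- Convexity. The order of `Lp ℝ ∞ P` is the `P`-a.s. order. -/
def IsConvex {P : Measure Ω} {ℱ : Filtration τ m} (ρ : RiskFamily P ℱ) : Prop :=
  ∀ (t : τ) (X Y : Lp ℝ ∞ P) (α : ℝ), 0 ≤ α → α ≤ 1 →
    (ρ t (α • X + (1 - α) • Y) : Lp ℝ ∞ P) ≤
      α • (ρ t X : Lp ℝ ∞ P) + (1 - α) • (ρ t Y : Lp ℝ ∞ P)

/-- Monotonicity (a larger payoff is less risky). -/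
def IsMonotone {P : Measure Ω} {ℱ : Filtration τ m} (ρ : RiskFamily P ℱ) : Prop :=
  ∀ (t : τ) (X Y : Lp ℝ ∞ P), X ≤ Y → (ρ t Y : Lp ℝ ∞ P) ≤ (ρ t X : Lp ℝ ∞ P)

/-- Cash-subadditivity: `ρ_t(X + m_t) ≥ ρ_t(X) - m_t` for `m_t ∈ L^∞_+(F_t)`. -/
def IsCashSubadditive {P : Measure Ω} {ℱ : Filtration τ m} (ρ : RiskFamily P ℱ) : Prop :=
  ∀ (t : τ) (X : Lp ℝ ∞ P) (mt : LInfty P ℱ t), 0 ≤ (mt : Lp ℝ ∞ P) →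
    (ρ t X : Lp ℝ ∞ P) - (mt : Lp ℝ ∞ P) ≤ (ρ t (X + (mt : Lp ℝ ∞ P)) : Lp ℝ ∞ P)

/-- Normalization. -/
def IsNormalized {P : Measure Ω} {ℱ : Filtration τ m} (ρ : RiskFamily P ℱ) : Prop :=
  ∀ t : τ, ρ t 0 = 0

/-- Regularity: `ρ_t(X 1_A + Y 1_{Aᶜ}) = 1_A ρ_t(X) + 1_{Aᶜ} ρ_t(Y)` for `A ∈ F_t`; here `Z` is the
element `X 1_A + Y 1_{Aᶜ}` of `L^∞`. -/
def IsRegular {P : Measure Ω} {ℱ : Filtration τ m} (ρ : RiskFamily P ℱ) : Prop :=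
  ∀ (t : τ) (A : Set Ω), MeasurableSet[ℱ t] A → ∀ X Y Z : Lp ℝ ∞ P,
    (∀ᵐ ω ∂P, Z ω = A.indicator X ω + Aᶜ.indicator Y ω) →
      ∀ᵐ ω ∂P, (ρ t Z : Lp ℝ ∞ P) ω =
        A.indicator (ρ t X : Lp ℝ ∞ P) ω + Aᶜ.indicator (ρ t Y : Lp ℝ ∞ P) ω

/-- Continuity from above of a single map `L^∞ → L^∞`: if `X_n` decreases to `X` a.s., then the
values at `X_n` converge a.s. to the value at `X`. -/
def ContinuousFromAbove {P : Measure Ω} (r : Lp ℝ ∞ P → Lp ℝ ∞ P) : Prop :=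
  ∀ (Xn : ℕ → Lp ℝ ∞ P) (X : Lp ℝ ∞ P), Antitone Xn →
    (∀ᵐ ω ∂P, Tendsto (fun n => Xn n ω) atTop (𝓝 (X ω))) →
      ∀ᵐ ω ∂P, Tendsto (fun n => r (Xn n) ω) atTop (𝓝 (r X ω))

/-- The set `𝒟` of adapted processes with values in `[0,1]`. -/
def discountFactors (ℱ : Filtration τ m) : Set (τ → Ω → ℝ) :=
  {D | (∀ s, Measurable[ℱ s] (D s)) ∧ ∀ s ω, 0 ≤ D s ω ∧ D s ω ≤ 1}

/-- The set `𝒬_t` of measures `Q ≪ P` on `(Ω, F)` with `Q = P` on `F_t`. They are probability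
measures if `P` is one, since `Ω ∈ F_t`. -/
def measuresAt (P : Measure Ω) (ℱ : Filtration τ m) (t : τ) : Set (Measure Ω) :=
  {Q | Q ≪ P ∧ ∀ A : Set Ω, MeasurableSet[ℱ t] A → Q A = P A}

/-- `Y` is (a version of) the essential supremum with respect to `P` of the family `f` of
extended-real random variables: the `P`-a.s. least measurable a.s. upper bound. -/
def IsEssSup {ι : Type*} (P : Measure Ω) (f : ι → Ω → EReal) (Y : Ω → EReal) : Prop :=
  Measurable Y ∧ (∀ i, f i ≤ᵐ[P] Y) ∧
    ∀ Z : Ω → EReal, Measurable Z → (∀ i, f i ≤ᵐ[P] Z) → Y ≤ᵐ[P] Z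

/-- `D_t E_Q[-X | F_t]`. -/
noncomputable def discountedCondExp {P : Measure Ω} (ℱ : Filtration τ m) (t : τ)
    (D : discountFactors ℱ) (Q : measuresAt P ℱ t) (X : Lp ℝ ∞ P) (ω : Ω) : ℝ :=
  D.1 t ω * (Q.1[fun ω' => -X ω' | ℱ t]) ω

/-- Candidates for a penalty term at time `t`: a nonnegative, possibly infinite, function of `ω` for
each `(D, Q) ∈ 𝒟 × 𝒬_t`. -/
abbrev PenaltyMap (P : Measure Ω) (ℱ : Filtration τ m) (t : τ) : Type _ :=
  discountFactors ℱ → measuresAt P ℱ t → Ω → ℝ≥0∞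

/-- Penalty terms at time `t`: all the values `c_t(DQ)` are `F_t`-measurable. -/
def IsPenaltyTerm {P : Measure Ω} {ℱ : Filtration τ m} {t : τ} (c : PenaltyMap P ℱ t) : Prop :=
  ∀ D Q, Measurable[ℱ t] (c D Q)

/-- `ρ_t(X) = ess sup_{(D,Q) ∈ 𝒟 × 𝒬_t} {D_t E_Q[-X | F_t] - c_t(DQ)}` for every `X ∈ L^∞`. -/
def IsRepresentedBy {P : Measure Ω} {ℱ : Filtration τ m} (ρ : RiskFamily P ℱ) (t : τ)
    (c : PenaltyMap P ℱ t) : Prop :=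
  ∀ X : Lp ℝ ∞ P,
    IsEssSup P
      (fun (p : discountFactors ℱ × measuresAt P ℱ t) (ω : Ω) =>
        (discountedCondExp ℱ t p.1 p.2 X ω : EReal) - (c p.1 p.2 ω : EReal))
      (fun ω => (((ρ t X : Lp ℝ ∞ P) ω : ℝ) : EReal))

/-- `c` is (a version of) the minimal penalty term of `ρ_t`:
`c(DQ) = ess sup_{X ∈ L^∞} {D_t E_Q[-X | F_t] - ρ_t(X)}` for every `(D, Q) ∈ 𝒟 × 𝒬_t`. -/
def IsMinimalPenalty {P : Measure Ω} {ℱ : Filtration τ m} (ρ : RiskFamily P ℱ) (t : τ)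
    (c : PenaltyMap P ℱ t) : Prop :=
  ∀ (D : discountFactors ℱ) (Q : measuresAt P ℱ t),
    IsEssSup P
      (fun (X : Lp ℝ ∞ P) (ω : Ω) =>
        ((discountedCondExp ℱ t D Q X ω - (ρ t X : Lp ℝ ∞ P) ω : ℝ) : EReal))
      (fun ω => (c D Q ω : EReal))

end DynRisk

/-! A representation gives continuity from above because each `D_t E_Q[-X | F_t] - c_t(DQ)` passes
to the limit along a subsequence of `X_n ↓ X`. So `sup_n ρ_t(X_n)` bounds the whole family at `X`,
hence bounds `ρ_t(X)`; monotonicity gives the other inequality.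

The converse scalarizes. The functional `φ(X) = E[ρ_t(X)]` is convex, decreasing and continuous from
above, so for `a < φ(X₀)` it should have an affine minorant with an integrable density `Y ≥ 0` and
value above `a` at `X₀` (`exists_affine_minorant`). Weak-star duality is replaced by Hilbert space
separation. The translated epigraph is a convex upper set missing `0` and closed under bounded
decreasing limits. Separations in `L²` at heights `r 2^n`, of summable cost, glue to a weight `Z ∈
L¹` that keeps the set away from `0` in `L²(Z μ)`, where one more separation yields `Y`
(`exists_density_step`, `exists_density`, `exists_integrable_separation`).

Cash-subadditivity forces `E[Y | F_t] ≤ 1`, so `Y` splits as `D_t = E[Y | F_t]` times the density of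
some `Q` agreeing with `P` on `F_t` (`exists_discount_factor_measure`). Regularity makes the family
defining the minimal penalty upward directed, so bounds on expectations pass to the essential
supremum (`exists_minimal_penalty`). The duality gap at `X₀` is nonnegative and, for suitable `(D,
Q)`, has arbitrarily small expectation; the infimum of such gaps vanishes a.s., which is the
representation. -/

open scoped Pointwise

/-! ### Separation in Hilbert space -/

/-- In a Hilbert space, a decreasing sequence of nonempty closed convex sets with a common bounded
superset has nonempty intersection. -/
theorem nonempty_iInter_of_antitone_convex {H : Type*} [NormedAddCommGroup H]
    [InnerProductSpace ℝ H] [CompleteSpace H] (K : ℕ → Set H) (hanti : Antitone K)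
    (hne : ∀ n, (K n).Nonempty) (hclosed : ∀ n, IsClosed (K n)) (hconv : ∀ n, Convex ℝ (K n))
    (hbdd : Bornology.IsBounded (K 0)) : (⋂ n, K n).Nonempty := by
  -- Points of minimal norm: their norms increase and stay bounded, and the variational inequality
  -- controls distances by increments of squared norms, so they form a Cauchy sequence.
  choose x hxK hx using fun n =>
    exists_norm_eq_iInf_of_complete_convex (hne n) (hclosed n).isComplete (hconv n) 0
  have hinner : ∀ n, ∀ y ∈ K n, ‖x n‖ ^ 2 ≤ inner ℝ (x n) y := by
    intro n y hy
    have h := (norm_eq_iInf_iff_real_inner_le_zero (hconv n) (hxK n)).1 (hx n) y hy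
    rw [zero_sub, inner_neg_left, inner_sub_right, real_inner_self_eq_norm_sq] at h
    linarith
  have hdist : ∀ i j, i ≤ j → ‖x j - x i‖ ^ 2 ≤ ‖x j‖ ^ 2 - ‖x i‖ ^ 2 := by
    intro i j hij
    have h := hinner i (x j) (hanti hij (hxK j))
    rw [norm_sub_sq_real, real_inner_comm]
    linarith
  have hmono : Monotone fun n => ‖x n‖ ^ 2 := by
    intro i j hij
    have := hdist i j hij
    have h2 := sq_nonneg ‖x j - x i‖
    simp only
    linarith
  obtain ⟨R, hR⟩ := hbdd.exists_norm_le
  have hbd : BddAbove (Set.range fun n => ‖x n‖ ^ 2) := by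
    refine ⟨R ^ 2, ?_⟩
    rintro _ ⟨n, rfl⟩
    exact pow_le_pow_left₀ (norm_nonneg _) (hR _ (hanti (Nat.zero_le n) (hxK n))) 2
  have hcauchy : CauchySeq x := by
    have hc := (tendsto_atTop_ciSup hmono hbd).cauchySeq
    rw [Metric.cauchySeq_iff'] at hc ⊢
    intro ε hε
    obtain ⟨N, hN⟩ := hc (ε ^ 2) (by positivity)
    refine ⟨N, fun n hn => ?_⟩
    have h1 := hN n hn
    rw [Real.dist_eq] at h1
    have h2 := hdist N n hn
    rw [dist_eq_norm]
    exact lt_of_pow_lt_pow_left₀ 2 hε.le (h2.trans_lt ((le_abs_self _).trans_lt h1))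
  obtain ⟨y, hy⟩ := cauchySeq_tendsto_of_complete hcauchy
  refine ⟨y, Set.mem_iInter.2 fun n => (hclosed n).mem_of_tendsto hy ?_⟩
  filter_upwards [eventually_ge_atTop n] with k hk using hanti hk (hxK k)

/-- Strict separation of a bounded closed convex set from a disjoint closed convex set in a
Hilbert space. -/
theorem exists_inner_add_le_of_disjoint {H : Type*} [NormedAddCommGroup H]
    [InnerProductSpace ℝ H] [CompleteSpace H] {K B : Set H} (hK : IsClosed K) (hKc : Convex ℝ K)
    (hKb : Bornology.IsBounded K) (hB : IsClosed B) (hBc : Convex ℝ B) (hdisj : Disjoint K B) :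
    ∃ (v : H) (δ : ℝ), 0 < δ ∧ ∀ k ∈ K, ∀ b ∈ B, inner ℝ v b + δ ≤ inner ℝ v k := by
  by_cases hne : (K - B).Nonempty
  swap
  · refine ⟨0, 1, one_pos, fun k hk b hb => (hne ⟨k - b, Set.sub_mem_sub hk hb⟩).elim⟩
  have hconv : Convex ℝ (closure (K - B)) := (hKc.sub hBc).closure
  obtain ⟨v, hv, hvmin⟩ := exists_norm_eq_iInf_of_complete_convex hne.closure
    isClosed_closure.isComplete hconv 0
  -- If the distance were zero, `K` would meet every closed thickening of `B`; the nested
  -- intersections, bounded because `K` is, would share a point of `K ∩ B`.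
  have hv0 : v ≠ 0 := by
    rintro rfl
    have hnested : (⋂ n : ℕ, K ∩ Metric.cthickening (1 / ((n : ℝ) + 1)) B).Nonempty := by
      refine nonempty_iInter_of_antitone_convex _ ?_ ?_ ?_ ?_ ?_
      · intro i j hij
        exact Set.inter_subset_inter_right _
          (Metric.cthickening_mono (one_div_le_one_div_of_le (by positivity) (by gcongr)) _)
      · intro n
        have hn : (0 : ℝ) < 1 / ((n : ℝ) + 1) := by positivity
        obtain ⟨z, hz, hzd⟩ := Metric.mem_closure_iff.1 hv _ hn
        obtain ⟨k, hk, b, hb, rfl⟩ := hz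
        refine ⟨k, hk, Metric.mem_cthickening_of_dist_le k b _ B hb ?_⟩
        rw [dist_zero_left] at hzd
        simpa [dist_eq_norm] using hzd.le
      · exact fun n => hK.inter Metric.isClosed_cthickening
      · exact fun n => hKc.inter (hBc.cthickening _)
      · exact hKb.subset Set.inter_subset_left
    obtain ⟨y, hy⟩ := hnested
    rw [Set.mem_iInter] at hy
    have hyB : y ∈ closure B := by
      rw [Metric.closure_eq_iInter_cthickening' B (Set.range fun n : ℕ => 1 / ((n : ℝ) + 1))]
      · simp only [Set.mem_range, Set.iInter_exists, Set.iInter_iInter_eq', Set.mem_iInter]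
        exact fun n => (hy n).2
      · intro ε hε
        obtain ⟨n, hn⟩ := exists_nat_one_div_lt hε
        exact ⟨_, ⟨n, rfl⟩, by positivity, hn.le⟩
    rw [hB.closure_eq] at hyB
    exact Set.disjoint_left.1 hdisj (hy 0).1 hyB
  refine ⟨v, ‖v‖ ^ 2, by positivity, fun k hk b hb => ?_⟩
  have h := (norm_eq_iInf_iff_real_inner_le_zero hconv hv).1 hvmin (k - b)
    (subset_closure (Set.sub_mem_sub hk hb))
  rw [zero_sub, inner_neg_left, inner_sub_right, inner_sub_right, real_inner_self_eq_norm_sq] at h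
  linarith

/-! ### Convex upper sets closed under decreasing limits -/

/-- A convex, upward closed set of essentially bounded functions, closed under bounded decreasing
a.e. limits. -/
structure IsFatouUpperSet {Ω : Type*} {m : MeasurableSpace Ω} (μ : Measure Ω)
    (C : Set (Ω → ℝ)) : Prop where
  memLp : ∀ X ∈ C, MemLp X ∞ μ
  convex : Convex ℝ C
  upper : ∀ X ∈ C, ∀ Y, MemLp Y ∞ μ → X ≤ᵐ[μ] Y → Y ∈ C
  fatou : ∀ (Xn : ℕ → Ω → ℝ) (X : Ω → ℝ), (∀ n, Xn n ∈ C) → MemLp X ∞ μ →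
    (∀ᵐ ω ∂μ, Antitone fun n => Xn n ω) →
    (∀ᵐ ω ∂μ, Tendsto (fun n => Xn n ω) atTop (𝓝 (X ω))) → X ∈ C

theorem memLp_top_of_ae_abs_le {Ω : Type*} {m : MeasurableSpace Ω} {μ : Measure Ω} {X : Ω → ℝ}
    (hX : AEStronglyMeasurable X μ) {R : ℝ} (h : ∀ᵐ ω ∂μ, |X ω| ≤ R) : MemLp X ∞ μ :=
  memLp_top_of_bound hX R (by simpa using h)

theorem exists_ae_abs_le_of_memLp_top {Ω : Type*} {m : MeasurableSpace Ω} {μ : Measure Ω}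
    {X : Ω → ℝ} (hX : MemLp X ∞ μ) : ∃ R : ℝ, 0 ≤ R ∧ ∀ᵐ ω ∂μ, |X ω| ≤ R := by
  refine ⟨(eLpNorm X ∞ μ).toReal, ENNReal.toReal_nonneg, ?_⟩
  have h := ae_le_eLpNormEssSup (f := X) (μ := μ)
  filter_upwards [h] with ω hω
  rw [← eLpNorm_exponent_top] at hω
  have := ENNReal.toReal_mono hX.2.ne hω
  simpa using this

/-- Tail suprema turn a bounded convergent sequence into a decreasing one with the same limit. For
upper sets this upgrades closure under decreasing limits to closure under bounded a.e. limits. -/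
theorem tendsto_iSup_add_of_tendsto {x : ℕ → ℝ} {a : ℝ} (hb : BddAbove (Set.range x))
    (hx : Tendsto x atTop (𝓝 a)) : Tendsto (fun n => ⨆ k, x (n + k)) atTop (𝓝 a) := by
  have hbn : ∀ n, BddAbove (Set.range fun k => x (n + k)) := fun n =>
    hb.mono (by rintro _ ⟨k, rfl⟩; exact ⟨n + k, rfl⟩)
  have hle : ∀ n, x n ≤ ⨆ k, x (n + k) := fun n => le_ciSup (hbn n) 0
  rw [tendsto_order] at hx ⊢
  refine ⟨fun b hba => ?_, fun b hba => ?_⟩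
  · filter_upwards [hx.1 b hba] with n hn using hn.trans_le (hle n)
  · obtain ⟨c, hc1, hc2⟩ := exists_between hba
    obtain ⟨N, hN⟩ := eventually_atTop.1 (hx.2 c hc1)
    filter_upwards [eventually_ge_atTop N] with n hn
    exact (ciSup_le fun k => (hN (n + k) (by omega)).le).trans_lt hc2

theorem antitone_iSup_add {x : ℕ → ℝ} (hb : BddAbove (Set.range x)) :
    Antitone (fun n => ⨆ k, x (n + k)) := by
  refine antitone_nat_of_succ_le fun n => ciSup_le fun k => ?_
  have hbn : BddAbove (Set.range fun k => x (n + k)) :=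
    hb.mono (by rintro _ ⟨k, rfl⟩; exact ⟨n + k, rfl⟩)
  have h := le_ciSup hbn (k + 1)
  have e : n + 1 + k = n + (k + 1) := by omega
  rw [e]
  exact h

namespace IsFatouUpperSet

variable {Ω : Type*} {m : MeasurableSpace Ω} {μ : Measure Ω} {C : Set (Ω → ℝ)}

/-- Bounded a.e. limits of elements of a Fatou closed upper set stay in the set. -/
theorem mem_of_tendsto (hC : IsFatouUpperSet μ C) {Xn : ℕ → Ω → ℝ} {X : Ω → ℝ} {R : ℝ}
    (hXn : ∀ n, Xn n ∈ C) (hR : ∀ n, ∀ᵐ ω ∂μ, |Xn n ω| ≤ R)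
    (hX : ∀ᵐ ω ∂μ, Tendsto (fun n => Xn n ω) atTop (𝓝 (X ω))) : X ∈ C := by
  have hR' := ae_all_iff.2 hR
  have hbd : ∀ ω, (∀ n, |Xn n ω| ≤ R) → BddAbove (Set.range fun n => Xn n ω) := by
    rintro ω h
    exact ⟨R, by rintro _ ⟨n, rfl⟩; exact (abs_le.1 (h n)).2⟩
  have hXm : AEStronglyMeasurable X μ :=
    aestronglyMeasurable_of_tendsto_ae atTop (fun n => (hC.memLp _ (hXn n)).1) hX
  refine hC.fatou (fun n ω => ⨆ k, Xn (n + k) ω) X (fun n => ?_) ?_ ?_ ?_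
  · refine hC.upper _ (hXn n) _ ?_ ?_
    · refine memLp_top_of_ae_abs_le (R := R) ?_ ?_
      · exact (AEMeasurable.iSup fun k =>
          (hC.memLp _ (hXn (n + k))).1.aemeasurable).aestronglyMeasurable
      · filter_upwards [hR'] with ω h
        have hbn : BddAbove (Set.range fun k => Xn (n + k) ω) :=
          (hbd ω h).mono (by rintro _ ⟨k, rfl⟩; exact ⟨n + k, rfl⟩)
        refine abs_le.2 ⟨(abs_le.1 (h n)).1.trans (le_ciSup hbn 0), ?_⟩
        exact ciSup_le fun k => (abs_le.1 (h (n + k))).2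
    · filter_upwards [hR'] with ω h
      have hbn : BddAbove (Set.range fun k => Xn (n + k) ω) :=
        (hbd ω h).mono (by rintro _ ⟨k, rfl⟩; exact ⟨n + k, rfl⟩)
      exact le_ciSup hbn 0
  · refine memLp_top_of_ae_abs_le (R := R) hXm ?_
    filter_upwards [hR', hX] with ω h h2
    exact le_of_tendsto h2.abs (Eventually.of_forall h)
  · filter_upwards [hR'] with ω h using antitone_iSup_add (hbd ω h)
  · filter_upwards [hR', hX] with ω h h2 using tendsto_iSup_add_of_tendsto (hbd ω h) h2

/-- If `0 ∉ C` then `C` contains no nonnegative function that is too small in sup norm. -/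
theorem exists_pos_forall_not_le (hC : IsFatouUpperSet μ C) (h0 : (0 : Ω → ℝ) ∉ C) :
    ∃ r : ℝ, 0 < r ∧ ∀ X ∈ C, 0 ≤ᵐ[μ] X → ¬ ∀ᵐ ω ∂μ, X ω ≤ r := by
  by_contra! hcon
  choose X hXC hX0 hXle using fun n : ℕ => hcon (1 / ((n : ℝ) + 1)) (by positivity)
  refine h0 (hC.mem_of_tendsto (R := 1) hXC (fun n => ?_) ?_)
  · filter_upwards [hX0 n, hXle n] with ω h1 h2
    rw [Pi.zero_apply] at h1
    rw [abs_of_nonneg h1]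
    refine h2.trans ?_
    rw [div_le_one (by positivity)]
    linarith [(n.cast_nonneg : (0 : ℝ) ≤ n)]
  · filter_upwards [ae_all_iff.2 hX0, ae_all_iff.2 hXle] with ω h1 h2
    exact squeeze_zero h1 h2 tendsto_one_div_add_atTop_nhds_zero_nat

/-- One step of the gluing argument: a density `u` that separates `C` from `0` among functions with
values in `[0, r]` can be enlarged, at cost at most `1 / r`, to separate among functions with values
in `[0, R]`. -/
theorem exists_density_step [IsFiniteMeasure μ] (hC : IsFatouUpperSet μ C) {r R : ℝ} (hr : 0 < r)
    {u : Ω → ℝ≥0∞} (hu : Measurable u) (hufin : ∫⁻ ω, u ω ∂μ ≠ ∞)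
    (hsep : ∀ X ∈ C, 0 ≤ᵐ[μ] X → (∀ᵐ ω ∂μ, X ω ≤ r) →
      1 < ∫⁻ ω, u ω * ENNReal.ofReal (X ω) ∂μ) :
    ∃ w : Ω → ℝ≥0∞, Measurable w ∧ ∫⁻ ω, w ω ∂μ ≤ ENNReal.ofReal (1 / r) ∧
      ∀ X ∈ C, 0 ≤ᵐ[μ] X → (∀ᵐ ω ∂μ, X ω ≤ R) →
        1 < ∫⁻ ω, (u ω + w ω) * ENNReal.ofReal (X ω) ∂μ := by
  -- `K` collects the elements with values in `[0, R]` on which `u` still fails. It misses `B`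
  -- because `u` already works up to height `r`.
  set K : Set (Lp ℝ 2 μ) := {f | (f : Ω → ℝ) ∈ C ∧ 0 ≤ᵐ[μ] (f : Ω → ℝ) ∧ (∀ᵐ ω ∂μ, f ω ≤ R) ∧
    ∫⁻ ω, u ω * ENNReal.ofReal (f ω) ∂μ ≤ 1} with hKdef
  set B : Set (Lp ℝ 2 μ) := {f | ∀ᵐ ω ∂μ, f ω ≤ r} with hBdef
  have hCcongr : ∀ {X Y : Ω → ℝ}, X ∈ C → X =ᵐ[μ] Y → Y ∈ C := fun {X Y} hX hXY =>
    hC.upper X hX Y ((memLp_congr_ae hXY).1 (hC.memLp X hX)) hXY.le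
  have hsub : ∀ {s : Set (Lp ℝ 2 μ)}, (∀ (fn : ℕ → Lp ℝ 2 μ) (f : Lp ℝ 2 μ), (∀ n, fn n ∈ s) →
      (∀ᵐ ω ∂μ, Tendsto (fun n => fn n ω) atTop (𝓝 (f ω))) → f ∈ s) → IsClosed s := by
    intro s hs
    refine IsSeqClosed.isClosed fun fn f hfn hlim => ?_
    obtain ⟨ns, -, hns⟩ := (tendstoInMeasure_of_tendsto_Lp hlim).exists_seq_tendsto_ae
    exact hs (fun n => fn (ns n)) f (fun n => hfn _) hns
  have hKclosed : IsClosed K := by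
    refine hsub fun fn f hfn hlim => ?_
    have hle := ae_all_iff.2 fun n => (hfn n).2.2.1
    have hge := ae_all_iff.2 fun n => (hfn n).2.1
    refine ⟨hC.mem_of_tendsto (R := R) (fun n => (hfn n).1) (fun n => ?_) hlim, ?_, ?_, ?_⟩
    · filter_upwards [(hfn n).2.1, (hfn n).2.2.1] with ω h1 h2
      rw [Pi.zero_apply] at h1
      rwa [abs_of_nonneg h1]
    · filter_upwards [hge, hlim] with ω h1 h2
      exact ge_of_tendsto' h2 h1
    · filter_upwards [hle, hlim] with ω h1 h2
      exact le_of_tendsto' h2 h1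
    -- `u` is only integrable, so the constraint need not be continuous on `L²`; Fatou's lemma gives
    -- the lower semicontinuity needed.
    · calc ∫⁻ ω, u ω * ENNReal.ofReal (f ω) ∂μ
          ≤ ∫⁻ ω, liminf (fun n => u ω * ENNReal.ofReal (fn n ω)) atTop ∂μ := by
            refine lintegral_mono_ae ?_
            filter_upwards [hlim, ae_lt_top hu hufin] with ω hω huω
            exact (ENNReal.Tendsto.const_mul (ENNReal.tendsto_ofReal hω)
              (Or.inr huω.ne)).liminf_eq.ge
        _ ≤ liminf (fun n => ∫⁻ ω, u ω * ENNReal.ofReal (fn n ω) ∂μ) atTop :=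
            lintegral_liminf_le fun n =>
              hu.mul (Lp.stronglyMeasurable (fn n)).measurable.ennreal_ofReal
        _ ≤ 1 := by
            refine liminf_le_of_le (by isBoundedDefault) fun b hb => ?_
            obtain ⟨n, hn⟩ := hb.exists
            exact hn.trans (hfn n).2.2.2
  have hBclosed : IsClosed B := by
    refine hsub fun fn f hfn hlim => ?_
    filter_upwards [ae_all_iff.2 hfn, hlim] with ω h1 h2 using le_of_tendsto' h2 h1
  have hcoe : ∀ (f g : Lp ℝ 2 μ) (a b : ℝ),
      ((a • f + b • g : Lp ℝ 2 μ) : Ω → ℝ) =ᵐ[μ] fun ω => a * f ω + b * g ω := by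
    intro f g a b
    filter_upwards [Lp.coeFn_add (a • f) (b • g), Lp.coeFn_smul a f, Lp.coeFn_smul b g]
      with ω h1 h2 h3
    rw [h1, Pi.add_apply, h2, h3]
    rfl
  have hBconv : Convex ℝ B := by
    intro f hf g hg a b ha hb hab
    change ∀ᵐ ω ∂μ, _
    filter_upwards [hcoe f g a b, hf, hg] with ω h1 h2 h3
    rw [h1]
    calc a * f ω + b * g ω ≤ a * r + b * r := by gcongr
      _ = r := by rw [← add_mul, hab, one_mul]
  have hKconv : Convex ℝ K := by
    intro f hf g hg a b ha hb hab
    refine ⟨hCcongr (hC.convex hf.1 hg.1 ha hb hab) (hcoe f g a b).symm, ?_, ?_, ?_⟩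
    · filter_upwards [hcoe f g a b, hf.2.1, hg.2.1] with ω h1 h2 h3
      rw [h1]
      exact add_nonneg (mul_nonneg ha h2) (mul_nonneg hb h3)
    · filter_upwards [hcoe f g a b, hf.2.2.1, hg.2.2.1] with ω h1 h2 h3
      rw [h1]
      calc a * f ω + b * g ω ≤ a * R + b * R := by gcongr
        _ = R := by rw [← add_mul, hab, one_mul]
    · have hfm := (Lp.stronglyMeasurable f).measurable.ennreal_ofReal
      have hgm := (Lp.stronglyMeasurable g).measurable.ennreal_ofReal
      calc ∫⁻ ω, u ω * ENNReal.ofReal ((a • f + b • g : Lp ℝ 2 μ) ω) ∂μ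
          = ∫⁻ ω, ENNReal.ofReal a * (u ω * ENNReal.ofReal (f ω)) +
              ENNReal.ofReal b * (u ω * ENNReal.ofReal (g ω)) ∂μ := by
            refine lintegral_congr_ae ?_
            filter_upwards [hcoe f g a b, hf.2.1, hg.2.1] with ω h1 h2 h3
            rw [h1, ENNReal.ofReal_add (mul_nonneg ha h2) (mul_nonneg hb h3),
              ENNReal.ofReal_mul ha, ENNReal.ofReal_mul hb]
            ring
        _ = ENNReal.ofReal a * ∫⁻ ω, u ω * ENNReal.ofReal (f ω) ∂μ +
              ENNReal.ofReal b * ∫⁻ ω, u ω * ENNReal.ofReal (g ω) ∂μ := by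
            rw [lintegral_add_left (by fun_prop), lintegral_const_mul _ (by fun_prop),
              lintegral_const_mul _ (by fun_prop)]
        _ ≤ ENNReal.ofReal a * 1 + ENNReal.ofReal b * 1 := by
            gcongr
            · exact hf.2.2.2
            · exact hg.2.2.2
        _ = 1 := by
            rw [mul_one, mul_one, ← ENNReal.ofReal_add ha hb, hab, ENNReal.ofReal_one]
  have hKbdd : Bornology.IsBounded K := by
    refine (isBounded_iff_forall_norm_le).2 ⟨_, fun f hf =>
      Lp.norm_le_of_ae_bound (C := |R|) (abs_nonneg _) ?_⟩
    filter_upwards [hf.2.1, hf.2.2.1] with ω h1 h2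
    rw [Pi.zero_apply] at h1
    rw [Real.norm_eq_abs, abs_of_nonneg h1]
    exact h2.trans (le_abs_self _)
  have hdisj : Disjoint K B := Set.disjoint_left.2 fun f hf hfB =>
    absurd (hsep f hf.1 hf.2.1 hfB) hf.2.2.2.not_gt
  have hmemK : ∀ X ∈ C, 0 ≤ᵐ[μ] X → (∀ᵐ ω ∂μ, X ω ≤ R) →
      ∫⁻ ω, u ω * ENNReal.ofReal (X ω) ∂μ ≤ 1 → ∃ f ∈ K, f =ᵐ[μ] X := by
    intro X hX hX0 hXR hint
    have hX2 : MemLp X 2 μ := (hC.memLp X hX).mono_exponent le_top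
    have hcoe := hX2.coeFn_toLp
    refine ⟨hX2.toLp X, ⟨hCcongr hX hcoe.symm, ?_, ?_, ?_⟩, hcoe⟩
    · filter_upwards [hcoe, hX0] with ω h1 h2
      rwa [h1]
    · filter_upwards [hcoe, hXR] with ω h1 h2
      rwa [h1]
    · refine le_trans (le_of_eq (lintegral_congr_ae ?_)) hint
      filter_upwards [hcoe] with ω h1
      rw [h1]
  -- If `u` already works up to height `R`, nothing has to be added.
  rcases K.eq_empty_or_nonempty with hKe | ⟨k₀, hk₀⟩
  · refine ⟨0, measurable_zero, by simp, fun X hX hX0 hXR => ?_⟩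
    by_contra! hcon
    obtain ⟨f, hf, -⟩ := hmemK X hX hX0 hXR (by simpa using hcon)
    simp [hKe] at hf
  obtain ⟨v, δ, hδ, hv⟩ := exists_inner_add_le_of_disjoint hKclosed hKconv hKbdd hBclosed
    hBconv hdisj
  have hinner : ∀ f : Lp ℝ 2 μ, inner ℝ v f = ∫ ω, v ω * f ω ∂μ := by
    intro f
    rw [L2.inner_def]
    refine integral_congr_ae (Eventually.of_forall fun ω => ?_)
    simp [mul_comm]
  have hintmul : ∀ f : Lp ℝ 2 μ, Integrable (fun ω => v ω * f ω) μ := fun f =>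
    (Lp.memLp v).integrable_mul (Lp.memLp f)
  have hvint : Integrable v μ := (Lp.memLp v).integrable one_le_two
  set c₀ : Lp ℝ 2 μ := (memLp_const r : MemLp (fun _ : Ω => r) 2 μ).toLp _ with hc₀
  have hc₀coe : c₀ =ᵐ[μ] fun _ => r := MemLp.coeFn_toLp _
  have hinner_c₀ : inner ℝ v c₀ = r * ∫ ω, v ω ∂μ := by
    rw [hinner, ← integral_const_mul]
    refine integral_congr_ae ?_
    filter_upwards [hc₀coe] with ω h
    rw [h, mul_comm]
  -- `B` is stable under subtracting nonnegative functions, so a functional bounded above on `B`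
  -- must be nonnegative on them.
  have hnonneg_inner : ∀ h : Lp ℝ 2 μ, 0 ≤ᵐ[μ] h → 0 ≤ inner ℝ v h := by
    intro h hh
    by_contra! hneg
    have hkey : ∀ c : ℝ, 0 ≤ c → inner ℝ v c₀ - c * inner ℝ v h + δ ≤ inner ℝ v k₀ := by
      intro c hc
      have hb : (1 : ℝ) • c₀ + (-c) • h ∈ B := by
        change ∀ᵐ ω ∂μ, _
        filter_upwards [hcoe c₀ h 1 (-c), hc₀coe, hh] with ω h1 h2 h3
        rw [Pi.zero_apply] at h3
        rw [h1, h2]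
        nlinarith
      have := hv k₀ hk₀ _ hb
      rw [inner_add_right, inner_smul_right, inner_smul_right] at this
      linarith
    set t := inner ℝ v h with ht
    set M := inner ℝ v k₀ - inner ℝ v c₀ with hM
    have h1 := hkey ((|M|) / (-t)) (by have := abs_nonneg M; have : 0 < -t := by linarith
                                       positivity)
    have h2 : |M| / (-t) * t = -|M| := by
      have : t ≠ 0 := hneg.ne
      field_simp
    rw [h2] at h1
    have := le_abs_self M
    linarith
  have hv0 : 0 ≤ᵐ[μ] v := by
    refine ae_nonneg_of_forall_setIntegral_nonneg hvint fun s hs hsμ => ?_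
    rw [← L2.inner_indicatorConstLp_one (𝕜 := ℝ) hs hsμ.ne v, real_inner_comm]
    refine hnonneg_inner _ ?_
    filter_upwards [indicatorConstLp_coeFn (p := 2) (hs := hs) (hμs := hsμ.ne) (c := (1 : ℝ))]
      with ω h
    rw [h]
    exact Set.indicator_nonneg (fun _ _ => zero_le_one) ω
  set V := ∫ ω, v ω ∂μ with hVdef
  have hKv : ∀ f ∈ K, r * V + δ ≤ ∫ ω, v ω * f ω ∂μ := by
    intro f hf
    rw [← hinner, ← hinner_c₀]
    exact hv f hf c₀ (by filter_upwards [hc₀coe] with ω h using h.le)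
  have hV : 0 < V := by
    refine (integral_nonneg_of_ae hv0).lt_of_ne' fun hV0 => ?_
    have hvz := (integral_eq_zero_iff_of_nonneg_ae hv0 hvint).1 hV0
    have h1 := hKv k₀ hk₀
    have h2 : ∫ ω, v ω * k₀ ω ∂μ = 0 := by
      refine integral_eq_zero_of_ae ?_
      filter_upwards [hvz] with ω h
      simp [h]
    rw [h2, hVdef, hV0] at h1
    linarith
  have hrV : 0 < r * V := by positivity
  -- The constant `r` lies in `B`, so `∫ v f > r V` on `K`. Dividing by `r V` makes the integral
  -- exceed `1` there, with total mass exactly `1 / r`.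
  refine ⟨fun ω => ENNReal.ofReal (v ω / (r * V)),
    ((Lp.stronglyMeasurable v).measurable.div_const _).ennreal_ofReal, ?_, ?_⟩
  · rw [← ofReal_integral_eq_lintegral_ofReal (hvint.div_const _)
      (by filter_upwards [hv0] with ω h using div_nonneg h hrV.le), integral_div, ← hVdef]
    refine ENNReal.ofReal_le_ofReal (le_of_eq ?_)
    field_simp
  · intro X hX hX0 hXR
    by_cases hu1 : 1 < ∫⁻ ω, u ω * ENNReal.ofReal (X ω) ∂μ
    · refine hu1.trans_le (lintegral_mono fun ω => ?_)
      gcongr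
      exact le_self_add
    obtain ⟨f, hf, hfX⟩ := hmemK X hX hX0 hXR (not_lt.1 hu1)
    have hgt : 1 < ∫⁻ ω, ENNReal.ofReal (v ω / (r * V)) * ENNReal.ofReal (X ω) ∂μ := by
      calc (1 : ℝ≥0∞) < ENNReal.ofReal ((r * V + δ) / (r * V)) := by
            rw [← ENNReal.ofReal_one]
            refine (ENNReal.ofReal_lt_ofReal_iff (by positivity)).2 ?_
            rw [lt_div_iff₀ hrV]
            linarith
        _ ≤ ENNReal.ofReal (∫ ω, v ω * f ω / (r * V) ∂μ) := by
            rw [integral_div]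
            refine ENNReal.ofReal_le_ofReal ?_
            gcongr
            exact hKv f hf
        _ = ∫⁻ ω, ENNReal.ofReal (v ω / (r * V)) * ENNReal.ofReal (X ω) ∂μ := by
            rw [ofReal_integral_eq_lintegral_ofReal ((hintmul f).div_const _)
              (by filter_upwards [hv0, hf.2.1] with ω h h'
                  exact div_nonneg (mul_nonneg h h') hrV.le)]
            refine lintegral_congr_ae ?_
            filter_upwards [hfX, hv0] with ω h1 h2
            rw [← ENNReal.ofReal_mul (div_nonneg h2 hrV.le), h1]
            congr 1
            ring
    refine hgt.trans_le (lintegral_mono fun ω => ?_)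
    gcongr
    exact le_add_self

end IsFatouUpperSet

namespace IsFatouUpperSet

variable {Ω : Type*} {m : MeasurableSpace Ω} {μ : Measure Ω} {C : Set (Ω → ℝ)}

/-- A Fatou closed convex upper set not containing `0` stays away from `0` on its nonnegative
elements in a weighted `L¹` norm. -/
theorem exists_density [IsFiniteMeasure μ] (hC : IsFatouUpperSet μ C) (h0 : (0 : Ω → ℝ) ∉ C) :
    ∃ Z : Ω → ℝ≥0∞, Measurable Z ∧ ∫⁻ ω, Z ω ∂μ ≠ ∞ ∧
      ∀ X ∈ C, 0 ≤ᵐ[μ] X → 1 < ∫⁻ ω, Z ω * ENNReal.ofReal (X ω) ∂μ := by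
  obtain ⟨r, hr, hCr⟩ := hC.exists_pos_forall_not_le h0
  -- The mass bound is the partial sum of the costs `1 / (r 2^k)`, `k < n`; it stays below `2 / r`.
  let S : ℕ → (Ω → ℝ≥0∞) → Prop := fun n u => Measurable u ∧
    ∫⁻ ω, u ω ∂μ ≤ ENNReal.ofReal ((2 - 2 / 2 ^ n) / r) ∧
    ∀ X ∈ C, 0 ≤ᵐ[μ] X → (∀ᵐ ω ∂μ, X ω ≤ r * 2 ^ n) →
      1 < ∫⁻ ω, u ω * ENNReal.ofReal (X ω) ∂μ
  have hstep : ∀ n u, S n u → ∃ w : Ω → ℝ≥0∞, S (n + 1) (u + w) := by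
    rintro n u ⟨hum, hui, hus⟩
    obtain ⟨w, hwm, hwi, hws⟩ := hC.exists_density_step (R := r * 2 ^ (n + 1))
      (by positivity : 0 < r * 2 ^ n) hum (hui.trans_lt ENNReal.ofReal_lt_top).ne hus
    refine ⟨w, hum.add hwm, ?_, hws⟩
    simp only [Pi.add_apply]
    rw [lintegral_add_left hum]
    refine (add_le_add hui hwi).trans ?_
    have h2 : (2 : ℝ) / 2 ^ n ≤ 2 := div_le_self (by norm_num) (one_le_pow₀ (by norm_num))
    rw [← ENNReal.ofReal_add (div_nonneg (by linarith) hr.le) (by positivity)]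
    refine ENNReal.ofReal_le_ofReal (le_of_eq ?_)
    field_simp
    ring
  choose! w hw using hstep
  let u : ℕ → Ω → ℝ≥0∞ := fun n => Nat.rec 0 (fun n v => v + w n v) n
  have hu : ∀ n, S n (u n) := by
    intro n
    induction n with
    | zero =>
      refine ⟨measurable_zero, by simp [u], fun X hX hX0 hXr => ?_⟩
      -- Height `r` costs nothing: by the choice of `r`, no nonnegative element of `C` lies below
      -- it.
      exact (hCr X hX hX0 (by simpa using hXr)).elim
    | succ n ih => exact hw n _ ih
  have hmono : Monotone u := monotone_nat_of_le_succ fun n => (le_self_add : u n ≤ u n + _)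
  refine ⟨fun ω => ⨆ n, u n ω, Measurable.iSup fun n => (hu n).1, ?_, fun X hX hX0 => ?_⟩
  · rw [lintegral_iSup (fun n => (hu n).1) hmono]
    refine ((iSup_le fun n => (hu n).2.1.trans ?_).trans_lt
      (ENNReal.ofReal_lt_top (r := 2 / r))).ne
    refine ENNReal.ofReal_le_ofReal ?_
    gcongr
    have : (0 : ℝ) ≤ 2 / 2 ^ n := by positivity
    linarith
  · obtain ⟨R, -, hR⟩ := exists_ae_abs_le_of_memLp_top (hC.memLp X hX)
    obtain ⟨n, hn⟩ := pow_unbounded_of_one_lt (R / r) (one_lt_two : (1 : ℝ) < 2)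
    refine ((hu n).2.2 X hX hX0 ?_).trans_le (lintegral_mono fun ω => ?_)
    · filter_upwards [hR] with ω hω
      rw [div_lt_iff₀ hr] at hn
      linarith [le_abs_self (X ω)]
    · gcongr
      exact le_iSup (fun n => u n ω) n

/-- A Fatou closed convex upper set not containing `0` is strictly separated from `0` by a
nonnegative integrable density. -/
theorem exists_integrable_separation [IsFiniteMeasure μ] (hC : IsFatouUpperSet μ C)
    (h0 : (0 : Ω → ℝ) ∉ C) :
    ∃ (Y : Ω → ℝ) (s : ℝ), Integrable Y μ ∧ 0 ≤ᵐ[μ] Y ∧ 0 < s ∧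
      ∀ X ∈ C, s ≤ ∫ ω, Y ω * X ω ∂μ := by
  rcases C.eq_empty_or_nonempty with rfl | ⟨X₀, hX₀⟩
  · exact ⟨0, 1, integrable_zero _ _ _, ae_of_all _ fun _ => le_rfl, one_pos, by simp⟩
  obtain ⟨Z, hZm, hZi, hZ⟩ := hC.exists_density h0
  set ν := μ.withDensity Z with hν
  have hνμ : ν ≪ μ := withDensity_absolutelyContinuous _ _
  have : IsFiniteMeasure ν := isFiniteMeasure_withDensity hZi
  have hZtop : ∀ᵐ ω ∂μ, Z ω < ∞ := ae_lt_top hZm hZi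
  have hCν : ∀ X ∈ C, MemLp X 2 ν := by
    intro X hX
    obtain ⟨R, -, hR⟩ := exists_ae_abs_le_of_memLp_top (hC.memLp X hX)
    exact (memLp_top_of_ae_abs_le ((hC.memLp X hX).1.mono_ac hνμ)
      (hνμ.ae_le hR)).mono_exponent le_top
  set S : Set (Lp ℝ 2 ν) := {f | ∃ X ∈ C, f =ᵐ[ν] X} with hS
  have hSconv : Convex ℝ S := by
    rintro f ⟨X, hX, hfX⟩ g ⟨Y, hY, hgY⟩ a b ha hb hab
    refine ⟨a • X + b • Y, hC.convex hX hY ha hb hab, ?_⟩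
    filter_upwards [Lp.coeFn_add (a • f) (b • g), Lp.coeFn_smul a f, Lp.coeFn_smul b g, hfX, hgY]
      with ω h1 h2 h3 h4 h5
    rw [h1, Pi.add_apply, h2, h3]
    simp [h4, h5]
  set M : ℝ := (ν Set.univ ^ (1 / 2 : ℝ)).toReal with hM
  have hMtop : ν Set.univ ^ (1 / 2 : ℝ) ≠ ∞ :=
    ENNReal.rpow_ne_top_of_nonneg (by norm_num) (measure_ne_top _ _)
  -- Positive parts stay in `C`, so `1 < ∫ Z X⁺ dμ = ∫ X⁺ dν`, and Cauchy–Schwarz on the finite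
  -- measure `ν` bounds this by the `L²(ν)` norm times `M`.
  have hSnorm : ∀ f ∈ S, 1 ≤ ‖f‖ * M := by
    rintro f ⟨X, hX, hfX⟩
    have hXm : AEStronglyMeasurable X μ := (hC.memLp X hX).1
    have hXp : (fun ω => max (X ω) 0) ∈ C := by
      refine hC.upper X hX _ ?_ (ae_of_all _ fun ω => le_max_left _ _)
      obtain ⟨R, hR0, hR⟩ := exists_ae_abs_le_of_memLp_top (hC.memLp X hX)
      refine memLp_top_of_ae_abs_le (R := R) (hXm.sup aestronglyMeasurable_const) ?_
      filter_upwards [hR] with ω hω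
      rw [abs_of_nonneg (le_max_right _ _)]
      exact max_le ((le_abs_self _).trans hω) hR0
    have h1 : 1 < eLpNorm f 2 ν * ν Set.univ ^ (1 / 2 : ℝ) := by
      calc (1 : ℝ≥0∞) < ∫⁻ ω, Z ω * ENNReal.ofReal (max (X ω) 0) ∂μ :=
            hZ _ hXp (ae_of_all _ fun ω => le_max_right _ _)
        _ = ∫⁻ ω, ENNReal.ofReal (max (X ω) 0) ∂ν := by
            rw [hν, lintegral_withDensity_eq_lintegral_mul₀ hZm.aemeasurable
              (hXm.aemeasurable.max aemeasurable_const).ennreal_ofReal]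
            rfl
        _ ≤ ∫⁻ ω, ‖f ω‖ₑ ∂ν := by
            refine lintegral_mono_ae ?_
            filter_upwards [hfX] with ω h
            rw [h, ← ofReal_norm, Real.norm_eq_abs]
            exact ENNReal.ofReal_le_ofReal (max_le (le_abs_self _) (abs_nonneg _))
        _ = eLpNorm f 1 ν := eLpNorm_one_eq_lintegral_enorm.symm
        _ ≤ eLpNorm f 2 ν * ν Set.univ ^ (1 / 2 : ℝ) := by
            have := eLpNorm_le_eLpNorm_mul_rpow_measure_univ (p := 1) (q := 2) (μ := ν)
              one_le_two (Lp.aestronglyMeasurable f)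
            norm_num at this ⊢
            exact this
    have h2 : (eLpNorm f 2 ν * ν Set.univ ^ (1 / 2 : ℝ)) ≠ ∞ :=
      ENNReal.mul_ne_top (Lp.eLpNorm_ne_top f) hMtop
    have h3 := ENNReal.toReal_mono h2 h1.le
    rw [ENNReal.toReal_mul] at h3
    simpa [Lp.norm_def, hM] using h3
  have hdisj : Disjoint ({0} : Set (Lp ℝ 2 ν)) (closure S) := by
    rw [Set.disjoint_singleton_left]
    intro h
    have hcl : IsClosed {f : Lp ℝ 2 ν | 1 ≤ ‖f‖ * M} :=
      isClosed_le continuous_const (by fun_prop)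
    have h1 : 1 ≤ ‖(0 : Lp ℝ 2 ν)‖ * M := closure_minimal hSnorm hcl h
    norm_num at h1
  obtain ⟨v, δ, hδ, hv⟩ := exists_inner_add_le_of_disjoint isClosed_singleton
    (convex_singleton (𝕜 := ℝ) (0 : Lp ℝ 2 ν)) Bornology.isBounded_singleton isClosed_closure
    hSconv.closure hdisj
  -- Separating `0` from `S` makes `v` negative on `S`; the density with respect to `μ` is therefore
  -- `-Z v`, integrable although `Z` need not be square integrable.
  have hsep : ∀ X ∈ C, δ ≤ ∫ ω, (-((Z ω).toReal * v ω)) * X ω ∂μ := by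
    intro X hX
    have hcoe := (hCν X hX).coeFn_toLp
    have h := hv 0 rfl ((hCν X hX).toLp X) (subset_closure ⟨X, hX, hcoe⟩)
    rw [inner_zero_right, L2.inner_def] at h
    have h2 : ∫ ω, inner ℝ (v ω) ((hCν X hX).toLp X ω) ∂ν = ∫ ω, v ω * X ω ∂ν := by
      refine integral_congr_ae ?_
      filter_upwards [hcoe] with ω hω
      simp [hω, mul_comm]
    rw [h2, show ∫ ω, v ω * X ω ∂ν = ∫ ω, (Z ω).toReal • (v ω * X ω) ∂μ from
      integral_withDensity_eq_integral_toReal_smul hZm hZtop _] at h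
    have h3 : ∫ ω, (-((Z ω).toReal * v ω)) * X ω ∂μ =
        -∫ ω, (Z ω).toReal • (v ω * X ω) ∂μ := by
      rw [← integral_neg]
      refine integral_congr_ae (ae_of_all _ fun ω => ?_)
      simp only [smul_eq_mul]
      ring
    rw [h3]
    linarith
  have hYint : Integrable (fun ω => -((Z ω).toReal * v ω)) μ := by
    have hvint : Integrable v ν := (Lp.memLp v).integrable one_le_two
    exact ((integrable_withDensity_iff_integrable_smul' hZm hZtop).1 hvint).neg
  refine ⟨_, δ, hYint, ?_, hδ, hsep⟩
  refine ae_nonneg_of_forall_setIntegral_nonneg hYint fun s hs _ => ?_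
  by_contra! hneg
  set Y : Ω → ℝ := fun ω => -((Z ω).toReal * v ω) with hY
  -- Adding `c 1_s` keeps `X₀` in `C`; if `∫_s Y < 0`, a large `c` violates the separation.
  have hkey : ∀ c : ℝ, 0 ≤ c → δ ≤ (∫ ω, Y ω * X₀ ω ∂μ) + c * ∫ ω in s, Y ω ∂μ := by
    intro c hc
    have hmem : (fun ω => X₀ ω + s.indicator (fun _ => c) ω) ∈ C := by
      refine hC.upper X₀ hX₀ _ ?_ (ae_of_all _ fun ω => ?_)
      · exact (hC.memLp X₀ hX₀).add ((memLp_const c).indicator hs)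
      · exact le_add_of_nonneg_right (Set.indicator_nonneg (fun _ _ => hc) ω)
    refine (hsep _ hmem).trans (le_of_eq ?_)
    obtain ⟨R, -, hR⟩ := exists_ae_abs_le_of_memLp_top (hC.memLp X₀ hX₀)
    have hi1 : Integrable (fun ω => Y ω * X₀ ω) μ :=
      hYint.mul_bdd (c := R) (hC.memLp X₀ hX₀).1 (by simpa using hR)
    have hi2 : Integrable (s.indicator fun ω => Y ω * c) μ := (hYint.mul_const c).indicator hs
    rw [mul_comm c, ← integral_mul_const, ← integral_indicator hs, ← integral_add hi1 hi2]
    refine integral_congr_ae (ae_of_all _ fun ω => ?_)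
    by_cases hω : ω ∈ s <;> simp [hω, hY] <;> ring
  set t := ∫ ω in s, Y ω ∂μ with ht
  set A := ∫ ω, Y ω * X₀ ω ∂μ with hA
  have ht0 : 0 < -t := by linarith
  have h1 := hkey (|A| / (-t)) (by positivity)
  have h2 : |A| / (-t) * t = -|A| := by
    have : t ≠ 0 := hneg.ne
    field_simp
  rw [h2] at h1
  linarith [le_abs_self A]

end IsFatouUpperSet

/-! ### Epigraphs as sets of functions on `Ω` with one extra atom -/

theorem measurableEmbedding_inl {α β : Type*} [MeasurableSpace α] [MeasurableSpace β] :
    MeasurableEmbedding (Sum.inl : α → α ⊕ β) :=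
  ⟨Sum.inl_injective, measurable_inl, fun _ hs => hs.inl_image⟩

theorem measurableEmbedding_inr {α β : Type*} [MeasurableSpace α] [MeasurableSpace β] :
    MeasurableEmbedding (Sum.inr : β → α ⊕ β) :=
  ⟨Sum.inr_injective, measurable_inr, fun _ hs => hs.inr_image⟩

/-- The disjoint union of a measure space with a point of mass one. -/
noncomputable def sumUnitMeasure {Ω : Type*} {m : MeasurableSpace Ω} (P : Measure Ω) :
    Measure (Ω ⊕ Unit) :=
  P.map Sum.inl + (Measure.dirac ()).map Sum.inr

section SumUnit

variable {Ω : Type*} {m : MeasurableSpace Ω} {P : Measure Ω}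

instance [IsFiniteMeasure P] : IsFiniteMeasure (sumUnitMeasure P) := by
  unfold sumUnitMeasure
  infer_instance

theorem ae_sumUnitMeasure_iff {p : Ω ⊕ Unit → Prop} :
    (∀ᵐ x ∂(sumUnitMeasure P), p x) ↔ (∀ᵐ ω ∂P, p (Sum.inl ω)) ∧ p (Sum.inr ()) := by
  unfold sumUnitMeasure
  rw [ae_add_measure_iff, measurableEmbedding_inl.ae_map_iff, measurableEmbedding_inr.ae_map_iff,
    ae_dirac_eq]
  exact Iff.rfl

theorem aestronglyMeasurable_sumUnitMeasure_iff {F : Ω ⊕ Unit → ℝ} :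
    AEStronglyMeasurable F (sumUnitMeasure P) ↔
      AEStronglyMeasurable (fun ω => F (Sum.inl ω)) P := by
  unfold sumUnitMeasure
  rw [aestronglyMeasurable_add_measure_iff, measurableEmbedding_inl.aestronglyMeasurable_map_iff,
    measurableEmbedding_inr.aestronglyMeasurable_map_iff]
  exact and_iff_left (StronglyMeasurable.of_discrete.aestronglyMeasurable)

theorem memLp_top_sumUnitMeasure_iff {F : Ω ⊕ Unit → ℝ} :
    MemLp F ∞ (sumUnitMeasure P) ↔ MemLp (fun ω => F (Sum.inl ω)) ∞ P := by
  constructor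
  · intro h
    obtain ⟨R, -, hR⟩ := exists_ae_abs_le_of_memLp_top h
    exact memLp_top_of_ae_abs_le (aestronglyMeasurable_sumUnitMeasure_iff.1 h.1)
      (ae_sumUnitMeasure_iff.1 hR).1
  · intro h
    obtain ⟨R, -, hR⟩ := exists_ae_abs_le_of_memLp_top h
    refine memLp_top_of_ae_abs_le (R := max R |F (Sum.inr ())|)
      (aestronglyMeasurable_sumUnitMeasure_iff.2 h.1) (ae_sumUnitMeasure_iff.2 ⟨?_, ?_⟩)
    · filter_upwards [hR] with ω hω using hω.trans (le_max_left _ _)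
    · exact le_max_right _ _

theorem integrable_of_sumUnitMeasure {F : Ω ⊕ Unit → ℝ} (hF : Integrable F (sumUnitMeasure P)) :
    Integrable (fun ω => F (Sum.inl ω)) P :=
  measurableEmbedding_inl.integrable_map_iff.1 (integrable_add_measure.1 hF).1

theorem integral_sumUnitMeasure {F : Ω ⊕ Unit → ℝ} (hF : Integrable F (sumUnitMeasure P)) :
    ∫ x, F x ∂(sumUnitMeasure P) = (∫ ω, F (Sum.inl ω) ∂P) + F (Sum.inr ()) := by
  have h := integrable_add_measure.1 hF
  unfold sumUnitMeasure
  rw [integral_add_measure h.1 h.2, measurableEmbedding_inl.integral_map,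
    measurableEmbedding_inr.integral_map, integral_dirac]

end SumUnit

theorem integrable_mul_coeFn_Lp_top {Ω : Type*} {m : MeasurableSpace Ω} {P : Measure Ω}
    {Y : Ω → ℝ} (hY : Integrable Y P) (X : Lp ℝ ∞ P) : Integrable (fun ω => Y ω * X ω) P := by
  obtain ⟨R, -, hR⟩ := exists_ae_abs_le_of_memLp_top (Lp.memLp X)
  exact hY.mul_bdd (c := R) (Lp.aestronglyMeasurable X) (by simpa using hR)

/-- A convex decreasing functional on `L^∞` that is continuous from above is, up to `ε`, minorized
at each point by an affine functional with an integrable density. -/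
theorem exists_affine_minorant {Ω : Type*} {m : MeasurableSpace Ω} {P : Measure Ω}
    [IsFiniteMeasure P] {φ : Lp ℝ ∞ P → ℝ} (hconv : ConvexOn ℝ Set.univ φ) (hanti : Antitone φ)
    (hcont : ∀ (Xn : ℕ → Lp ℝ ∞ P) (X : Lp ℝ ∞ P), Antitone Xn →
      (∀ᵐ ω ∂P, Tendsto (fun n => Xn n ω) atTop (𝓝 (X ω))) →
      Tendsto (fun n => φ (Xn n)) atTop (𝓝 (φ X)))
    (X₀ : Lp ℝ ∞ P) {a : ℝ} (ha : a < φ X₀) :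
    ∃ Y : Ω → ℝ, Integrable Y P ∧ 0 ≤ᵐ[P] Y ∧
      ∀ X : Lp ℝ ∞ P, -(∫ ω, Y ω * X ω ∂P) - φ X ≤ -(∫ ω, Y ω * X₀ ω ∂P) - a := by
  -- The epigraph of `φ`, translated so that `(X₀, a)` becomes `0`; the atom carries the real
  -- coordinate. That `0` is not in `C` is exactly `a < φ X₀`.
  set C : Set (Ω ⊕ Unit → ℝ) := {F | ∃ X : Lp ℝ ∞ P,
    (∀ᵐ ω ∂P, F (Sum.inl ω) = X ω - X₀ ω) ∧ φ X ≤ F (Sum.inr ()) + a} with hCdef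
  have hmem : ∀ F ∈ C, MemLp F ∞ (sumUnitMeasure P) := by
    rintro F ⟨X, hFX, -⟩
    rw [memLp_top_sumUnitMeasure_iff]
    exact (memLp_congr_ae hFX).2 ((Lp.memLp X).sub (Lp.memLp X₀))
  have hrep : ∀ F : Ω ⊕ Unit → ℝ, MemLp F ∞ (sumUnitMeasure P) →
      ∃ X : Lp ℝ ∞ P, ∀ᵐ ω ∂P, F (Sum.inl ω) = X ω - X₀ ω := by
    intro F hF
    have h := (memLp_top_sumUnitMeasure_iff.1 hF).add (Lp.memLp X₀)
    refine ⟨h.toLp _, ?_⟩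
    filter_upwards [h.coeFn_toLp] with ω hω
    rw [hω]
    simp
  have hC : IsFatouUpperSet (sumUnitMeasure P) C := by
    refine ⟨hmem, ?_, ?_, ?_⟩
    · rintro F ⟨X, hX, hFX⟩ G ⟨Y, hY, hGY⟩ c d hc hd hcd
      refine ⟨c • X + d • Y, ?_, ?_⟩
      · filter_upwards [Lp.coeFn_add (c • X) (d • Y), Lp.coeFn_smul c X, Lp.coeFn_smul d Y, hX, hY]
          with ω h1 h2 h3 h4 h5
        simp only [Pi.add_apply] at h1 ⊢
        rw [h1, h2, h3]
        simp only [Pi.smul_apply, smul_eq_mul, h4, h5]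
        linear_combination (-X₀ ω) * hcd
      · refine (hconv.2 (Set.mem_univ X) (Set.mem_univ Y) hc hd hcd).trans ?_
        simp only [Pi.add_apply, Pi.smul_apply, smul_eq_mul]
        have h1 := mul_le_mul_of_nonneg_left hFX hc
        have h2 := mul_le_mul_of_nonneg_left hGY hd
        have h3 : c * a + d * a = a := by rw [← add_mul, hcd, one_mul]
        linarith
    · rintro F ⟨X, hX, hFX⟩ G hG hFG
      obtain ⟨Y, hY⟩ := hrep G hG
      obtain ⟨hle1, hle2⟩ := ae_sumUnitMeasure_iff.1 hFG
      refine ⟨Y, hY, (hanti ?_ : φ Y ≤ φ X).trans (by linarith)⟩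
      rw [← Lp.coeFn_le]
      filter_upwards [hX, hY, hle1] with ω h1 h2 h3
      linarith
    · intro Fn F hFn hF hFanti hFlim
      choose X hX hFX using hFn
      obtain ⟨Y, hY⟩ := hrep F hF
      obtain ⟨hanti1, hanti2⟩ := ae_sumUnitMeasure_iff.1 hFanti
      obtain ⟨hlim1, hlim2⟩ := ae_sumUnitMeasure_iff.1 hFlim
      refine ⟨Y, hY, ?_⟩
      refine le_of_tendsto_of_tendsto' (hcont X Y ?_ ?_) (hlim2.add_const a) hFX
      · refine fun i j hij => ?_
        rw [← Lp.coeFn_le]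
        filter_upwards [hX i, hX j, hanti1] with ω h1 h2 h3
        have := h3 hij
        simp only at this
        linarith
      · filter_upwards [ae_all_iff.2 hX, hY, hlim1] with ω h1 h2 h3
        have := h3.add_const (X₀ ω)
        simpa [h1, h2] using this
  have h0 : (0 : Ω ⊕ Unit → ℝ) ∉ C := by
    rintro ⟨X, hX, hφ⟩
    have : X = X₀ := by
      refine Lp.ext ?_
      filter_upwards [hX] with ω hω
      simp only [Pi.zero_apply] at hω
      linarith
    simp only [this, Pi.zero_apply] at hφ
    linarith
  obtain ⟨Y, s, hYi, hY0, hs, hsep⟩ := hC.exists_integrable_separation h0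
  obtain ⟨hY1, hY2⟩ := ae_sumUnitMeasure_iff.1 hY0
  have hYi1 := integrable_of_sumUnitMeasure hYi
  set z := Y (Sum.inr ()) with hz
  have hkey : ∀ X : Lp ℝ ∞ P, s ≤ (∫ ω, Y (Sum.inl ω) * X ω ∂P) -
      (∫ ω, Y (Sum.inl ω) * X₀ ω ∂P) + z * (φ X - a) := by
    intro X
    have hFC : Sum.elim (fun ω => X ω - X₀ ω) (fun _ => φ X - a) ∈ C :=
      ⟨X, ae_of_all _ fun ω => rfl, by simp⟩
    obtain ⟨R, -, hR⟩ := exists_ae_abs_le_of_memLp_top (hmem _ hFC)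
    have hint := hYi.mul_bdd (c := R) (hmem _ hFC).1 (by simpa using hR)
    refine (hsep _ hFC).trans (le_of_eq ?_)
    rw [integral_sumUnitMeasure hint, ← integral_sub (integrable_mul_coeFn_Lp_top hYi1 X)
      (integrable_mul_coeFn_Lp_top hYi1 X₀)]
    simp only [Sum.elim_inl, Sum.elim_inr, mul_sub]
    rfl
  -- The separating functional is not vertical: at `X₀` the inequality reads `s ≤ z (φ X₀ - a)`.
  -- Dividing by `z` then gives the affine minorant.
  have hz0 : 0 < z := by
    refine lt_of_le_of_ne hY2 fun h => ?_
    have := hkey X₀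
    rw [← h] at this
    linarith
  refine ⟨fun ω => Y (Sum.inl ω) / z, hYi1.div_const z, ?_, fun X => ?_⟩
  · filter_upwards [hY1] with ω h using div_nonneg h hz0.le
  · have hdiv : ∀ X : Lp ℝ ∞ P, ∫ ω, Y (Sum.inl ω) / z * X ω ∂P =
        (∫ ω, Y (Sum.inl ω) * X ω ∂P) / z := by
      intro X
      rw [← integral_div]
      exact integral_congr_ae (ae_of_all _ fun ω => by simp only; ring)
    have h := hkey X
    rw [hdiv, hdiv]
    have h1 : 0 ≤ ((∫ ω, Y (Sum.inl ω) * X ω ∂P) - (∫ ω, Y (Sum.inl ω) * X₀ ω ∂P) +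
        z * (φ X - a)) / z := div_nonneg (by linarith) hz0.le
    rw [add_div, sub_div, mul_div_cancel_left₀ _ hz0.ne'] at h1
    linarith

/-! ### Measures agreeing on a sub-σ-algebra and factorization of densities -/

section TrimEq

variable {Ω : Type*} {G m : MeasurableSpace Ω} {P Q : Measure Ω}

theorem trim_eq_of_measure_eq (hG : G ≤ m) (h : ∀ A, MeasurableSet[G] A → Q A = P A) :
    Q.trim hG = P.trim hG := by
  refine @Measure.ext Ω G _ _ fun A hA => ?_
  rw [trim_measurableSet_eq hG hA, trim_measurableSet_eq hG hA, h A hA]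

theorem integral_eq_of_trim_eq (hG : G ≤ m) (h : ∀ A, MeasurableSet[G] A → Q A = P A) {f : Ω → ℝ}
    (hf : StronglyMeasurable[G] f) : ∫ ω, f ω ∂Q = ∫ ω, f ω ∂P := by
  rw [integral_trim hG hf, integral_trim hG hf, trim_eq_of_measure_eq hG h]

theorem memLp_top_of_absolutelyContinuous {X : Ω → ℝ} (hX : MemLp X ∞ P) (hQ : Q ≪ P) :
    MemLp X ∞ Q := by
  obtain ⟨R, -, hR⟩ := exists_ae_abs_le_of_memLp_top hX
  exact memLp_top_of_ae_abs_le (hX.1.mono_ac hQ) (hQ.ae_le hR)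

theorem isProbabilityMeasure_of_measure_eq [IsProbabilityMeasure P]
    (h : ∀ A, MeasurableSet[G] A → Q A = P A) : IsProbabilityMeasure Q :=
  ⟨by rw [h _ (@MeasurableSet.univ Ω G), measure_univ]⟩

end TrimEq

/-- A density `Y` whose conditional expectation given `G` is at most one factors as a `G`-measurable
discount factor times the density of a probability measure that agrees with `P` on `G`. -/
theorem exists_discount_factor_measure {Ω : Type*} {G m : MeasurableSpace Ω} (hG : G ≤ m)
    {P : Measure Ω} [IsProbabilityMeasure P] {Y : Ω → ℝ} (hYi : Integrable Y P)
    (hY0 : 0 ≤ᵐ[P] Y) (hYG : ∀ A, MeasurableSet[G] A → ∫ ω in A, Y ω ∂P ≤ P.real A) :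
    ∃ D : Ω → ℝ, Measurable[G] D ∧ (∀ ω, 0 ≤ D ω ∧ D ω ≤ 1) ∧
      ∃ Q : Measure Ω, Q ≪ P ∧ (∀ A, MeasurableSet[G] A → Q A = P A) ∧
        ∀ X : Ω → ℝ, MemLp X ∞ P → ∫ ω, D ω * (Q[X | G]) ω ∂P = ∫ ω, Y ω * X ω ∂P := by
  set y : Ω → ℝ≥0∞ := fun ω => ENNReal.ofReal (hYi.1.mk Y ω) with hy
  have hym : Measurable y := hYi.1.stronglyMeasurable_mk.measurable.ennreal_ofReal
  have hyY : ∀ᵐ ω ∂P, y ω = ENNReal.ofReal (Y ω) := by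
    filter_upwards [hYi.1.ae_eq_mk] with ω h
    rw [hy, h]
  set ν := P.withDensity y with hν
  have hνA : ∀ A, MeasurableSet[G] A → ν A ≤ P A := by
    intro A hA
    rw [hν, withDensity_apply _ (hG A hA), lintegral_congr_ae (ae_restrict_of_ae hyY),
      ← ofReal_integral_eq_lintegral_ofReal hYi.integrableOn (ae_restrict_of_ae hY0)]
    exact (ENNReal.ofReal_le_ofReal (hYG A hA)).trans_eq (ofReal_measureReal (measure_ne_top _ _))
  have hνle : ν.trim hG ≤ P.trim hG := by
    refine (@Measure.le_iff Ω G _ _).2 fun A hA => ?_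
    rw [trim_measurableSet_eq hG hA, trim_measurableSet_eq hG hA]
    exact hνA A hA
  have : IsFiniteMeasure ν := ⟨(hνA _ (@MeasurableSet.univ Ω G)).trans_lt (measure_lt_top _ _)⟩
  -- `d` is a version of `E_P[Y | G]`, obtained as a density on `G`; below, `e` truncates it to be
  -- at most `1` everywhere.
  set d : Ω → ℝ≥0∞ := (ν.trim hG).rnDeriv (P.trim hG) with hd
  have hdm : Measurable[G] d := Measure.measurable_rnDeriv _ _
  have hd1 : ∀ᵐ ω ∂P, d ω ≤ 1 := ae_of_ae_trim hG (Measure.rnDeriv_le_one_of_le hνle)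
  have hdens : (P.trim hG).withDensity d = ν.trim hG :=
    Measure.withDensity_rnDeriv_eq _ _ (Measure.absolutelyContinuous_of_le hνle)
  have hint : ∀ h : Ω → ℝ≥0∞, Measurable[G] h →
      ∫⁻ ω, y ω * h ω ∂P = ∫⁻ ω, d ω * h ω ∂P := by
    intro h hh
    have h1 : ∫⁻ ω, h ω ∂ν = ∫⁻ ω, y ω * h ω ∂P :=
      lintegral_withDensity_eq_lintegral_mul _ hym (hh.mono hG le_rfl)
    have h2 : ∫⁻ ω, d ω * h ω ∂(P.trim hG) = ∫⁻ ω, d ω * h ω ∂P := lintegral_trim hG (hdm.mul hh)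
    rw [← h1, ← lintegral_trim hG hh, ← h2, ← hdens,
      lintegral_withDensity_eq_lintegral_mul _ hdm hh]
    rfl
  set e : Ω → ℝ≥0∞ := fun ω => min (d ω) 1 with he
  have hem : Measurable[G] e := hdm.min measurable_const
  have hed : ∀ᵐ ω ∂P, d ω = e ω := by
    filter_upwards [hd1] with ω h using (min_eq_left h).symm
  have hetop : ∀ ω, e ω ≠ ∞ := fun ω => ((min_le_right _ _).trans_lt ENNReal.one_lt_top).ne
  have hZ : MeasurableSet[G] {ω | e ω = 0} := hem (@measurableSet_singleton ℝ≥0∞ _ _ 0)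
  -- The density `Y / E[Y | G]`, set to `1` where the denominator vanishes so that `Q` still agrees
  -- with `P` there.
  set q : Ω → ℝ≥0∞ := fun ω => {ω | e ω = 0}.indicator (fun _ => 1) ω +
    y ω * {ω | e ω = 0}ᶜ.indicator (fun ω => (e ω)⁻¹) ω with hq
  have hiG : Measurable[G] ({ω | e ω = 0}ᶜ.indicator fun ω => (e ω)⁻¹) :=
    hem.inv.indicator hZ.compl
  have hqm : Measurable q :=
    (measurable_const.indicator (hG _ hZ)).add (hym.mul (hiG.mono hG le_rfl))
  have hQP : ∀ A, MeasurableSet[G] A → P.withDensity q A = P A := by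
    intro A hA
    have h1 : ∫⁻ ω in A, y ω * {ω | e ω = 0}ᶜ.indicator (fun ω => (e ω)⁻¹) ω ∂P =
        ∫⁻ ω in A, {ω | e ω = 0}ᶜ.indicator (fun _ => 1) ω ∂P := by
      rw [← lintegral_indicator (hG A hA), ← lintegral_indicator (hG A hA)]
      calc ∫⁻ ω, A.indicator (fun ω => y ω * {ω | e ω = 0}ᶜ.indicator (fun ω => (e ω)⁻¹) ω) ω ∂P
          = ∫⁻ ω, y ω * A.indicator ({ω | e ω = 0}ᶜ.indicator (fun ω => (e ω)⁻¹)) ω ∂P := by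
            refine lintegral_congr fun ω => ?_
            by_cases hω : ω ∈ A <;> simp [hω]
        _ = ∫⁻ ω, d ω * A.indicator ({ω | e ω = 0}ᶜ.indicator (fun ω => (e ω)⁻¹)) ω ∂P :=
            hint _ (hiG.indicator hA)
        _ = _ := by
            refine lintegral_congr_ae ?_
            filter_upwards [hed] with ω hω
            rw [hω]
            by_cases hA : ω ∈ A <;> by_cases hz : e ω = 0 <;>
              simp [hA, hz, ENNReal.mul_inv_cancel, hetop]
    rw [withDensity_apply _ (hG A hA), lintegral_add_left (measurable_const.indicator (hG _ hZ)),
      h1, ← lintegral_add_left (measurable_const.indicator (hG _ hZ))]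
    have h2 : ∀ ω, {ω | e ω = 0}.indicator (fun _ => (1 : ℝ≥0∞)) ω +
        {ω | e ω = 0}ᶜ.indicator (fun _ => 1) ω = 1 := by
      intro ω
      by_cases hz : e ω = 0 <;> simp [hz]
    simp [h2]
  -- Where the conditional expectation of `Y ≥ 0` is zero, so is `Y`; hence `e q = y` despite the
  -- arbitrary value of `q`.
  have hy0 : ∀ᵐ ω ∂P, e ω = 0 → y ω = 0 := by
    have h1 := hint ({ω | e ω = 0}.indicator fun _ => 1) (measurable_const.indicator hZ)
    have h2 : ∫⁻ ω, d ω * {ω | e ω = 0}.indicator (fun _ => 1) ω ∂P = 0 := by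
      rw [lintegral_eq_zero_iff (f := fun ω => d ω * {ω | e ω = 0}.indicator (fun _ => 1) ω)
        ((hdm.mono hG le_rfl).mul (measurable_const.indicator (hG _ hZ)))]
      filter_upwards [hed] with ω hω
      by_cases hz : e ω = 0 <;> simp [hz, hω]
    rw [h2, lintegral_eq_zero_iff (f := fun ω => y ω * {ω | e ω = 0}.indicator (fun _ => 1) ω)
      (hym.mul (measurable_const.indicator (hG _ hZ)))] at h1
    filter_upwards [h1] with ω hω hz
    simpa [hz] using hω
  have heq : ∀ᵐ ω ∂P, e ω * q ω = y ω := by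
    filter_upwards [hy0] with ω hω
    by_cases hz : e ω = 0
    · simp [hz, hω hz]
    · simp only [hq, Set.mem_ofPred_eq, hz, not_false_eq_true, Set.indicator_of_notMem, zero_add,
        Set.mem_compl_iff, Set.indicator_of_mem]
      rw [mul_left_comm, ENNReal.mul_inv_cancel hz (hetop ω), mul_one]
  set Q := P.withDensity q with hQ
  have hac : Q ≪ P := withDensity_absolutelyContinuous _ _
  have hQprob : IsProbabilityMeasure Q := isProbabilityMeasure_of_measure_eq hQP
  have hqi : ∫⁻ ω, q ω ∂P ≠ ∞ := by
    rw [← setLIntegral_univ, ← withDensity_apply _ MeasurableSet.univ]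
    exact measure_ne_top Q _
  have hDm : Measurable[G] fun ω => (e ω).toReal := hem.ennreal_toReal
  refine ⟨fun ω => (e ω).toReal, hDm, fun ω => ⟨ENNReal.toReal_nonneg, ?_⟩, Q, hac, hQP, ?_⟩
  · exact ENNReal.toReal_le_of_le_ofReal zero_le_one (by simp [he])
  · intro X hX
    have hXQ : MemLp X ∞ Q := memLp_top_of_absolutelyContinuous hX hac
    have hDX : Integrable (fun ω => (e ω).toReal * X ω) Q := by
      refine (hXQ.integrable le_top).bdd_mul (c := 1)
        (hDm.mono hG le_rfl).aestronglyMeasurable (ae_of_all _ fun ω => ?_)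
      rw [Real.norm_eq_abs, abs_of_nonneg ENNReal.toReal_nonneg]
      exact ENNReal.toReal_le_of_le_ofReal zero_le_one (by simp [he])
    have hpull : Q[fun ω => (e ω).toReal * X ω | G] =ᵐ[Q] fun ω => (e ω).toReal * (Q[X | G]) ω :=
      condExp_mul_of_stronglyMeasurable_left hDm.stronglyMeasurable hDX (hXQ.integrable le_top)
    -- The integrand is `G`-measurable, so `P` can be replaced by `Q`, after which the conditional
    -- expectation drops out.
    have htrim : ∫ ω, (e ω).toReal * (Q[X | G]) ω ∂Q = ∫ ω, (e ω).toReal * (Q[X | G]) ω ∂P :=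
      integral_eq_of_trim_eq hG hQP (hDm.stronglyMeasurable.mul stronglyMeasurable_condExp)
    rw [← htrim, ← integral_congr_ae hpull,
      integral_condExp hG, hQ, integral_withDensity_eq_integral_toReal_smul hqm
        (ae_lt_top hqm hqi)]
    refine integral_congr_ae ?_
    filter_upwards [heq, hyY, hY0] with ω h1 h2 h3
    rw [smul_eq_mul, ← mul_assoc, ← ENNReal.toReal_mul, mul_comm (q ω), h1, h2,
      ENNReal.toReal_ofReal h3]

/-! ### Essential suprema -/

/-- Every nonempty family of `[0, ∞]`-valued random variables has a countable subfamily whose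
supremum is an a.e. upper bound of the whole family. -/
theorem exists_seq_forall_ae_le_iSup {Ω ι : Type*} {m : MeasurableSpace Ω} {P : Measure Ω}
    [IsFiniteMeasure P] [Nonempty ι] {F : ι → Ω → ℝ≥0∞} (hF : ∀ i, AEMeasurable (F i) P) :
    ∃ s : ℕ → ι, ∀ i, ∀ᵐ ω ∂P, F i ω ≤ ⨆ n, F (s n) ω := by
  -- The map `x ↦ (1 + x)⁻¹` is injective and decreasing on `[0, ∞]` with values at most `1`, so the
  -- best countable subfamily can be sought by minimizing a finite integral.
  let g : (ℕ → ι) → Ω → ℝ≥0∞ := fun s ω => (1 + ⨆ n, F (s n) ω)⁻¹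
  have hgm : ∀ s, AEMeasurable (g s) P := fun s =>
    (aemeasurable_const.add (AEMeasurable.iSup fun n => hF (s n))).inv
  have hg1 : ∀ s ω, g s ω ≤ 1 := fun s ω => ENNReal.inv_le_one.2 le_self_add
  have hgfin : ∀ s, ∫⁻ ω, g s ω ∂P ≠ ∞ := fun s =>
    ((lintegral_mono (hg1 s)).trans_lt (by simp)).ne
  set M := ⨅ s, ∫⁻ ω, g s ω ∂P with hM
  have hMfin : M ≠ ∞ := ((iInf_le _ (fun _ => Classical.arbitrary ι)).trans_lt
    (hgfin _).lt_top).ne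
  have hseq : ∀ k : ℕ, ∃ s, ∫⁻ ω, g s ω ∂P < M + ((k : ℝ≥0∞) + 1)⁻¹ := fun k =>
    iInf_lt_iff.1 (ENNReal.lt_add_right hMfin (by simp))
  choose S hS using hseq
  -- Merges the nearly minimizing sequences into one, which attains the infimum; prepending any `i`
  -- then cannot change the supremum a.e.
  let s : ℕ → ι := fun n => S n.unpair.1 n.unpair.2
  have hgs : ∫⁻ ω, g s ω ∂P ≤ M := by
    have hk : ∀ k : ℕ, ∫⁻ ω, g s ω ∂P ≤ M + ((k : ℝ≥0∞) + 1)⁻¹ := by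
      intro k
      refine (lintegral_mono fun ω => ?_).trans (hS k).le
      refine ENNReal.inv_le_inv.2 (add_le_add le_rfl (iSup_le fun n => ?_))
      have := le_iSup (fun n => F (s n) ω) (Nat.pair k n)
      simpa [s] using this
    have hlim : Tendsto (fun k : ℕ => M + ((k : ℝ≥0∞) + 1)⁻¹) atTop (𝓝 (M + 0)) := by
      refine tendsto_const_nhds.add ?_
      have := (tendsto_add_atTop_iff_nat 1).2 ENNReal.tendsto_inv_nat_nhds_zero
      simpa using this
    rw [add_zero] at hlim
    exact ge_of_tendsto' hlim hk
  refine ⟨s, fun i => ?_⟩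
  let s' : ℕ → ι := fun n => Nat.casesOn n i s
  have hle : ∀ ω, g s' ω ≤ g s ω := fun ω =>
    ENNReal.inv_le_inv.2 (add_le_add le_rfl
      (iSup_le fun n => le_iSup (fun n => F (s' n) ω) (n + 1)))
  have heq := ae_eq_of_ae_le_of_lintegral_le (ae_of_all _ hle) (hgfin s') (hgm s)
    (hgs.trans (iInf_le _ s'))
  filter_upwards [heq] with ω hω
  have h1 : (1 : ℝ≥0∞) + ⨆ n, F (s' n) ω = 1 + ⨆ n, F (s n) ω := inv_injective hω
  rw [← (ENNReal.add_right_inj ENNReal.one_ne_top).1 h1]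
  exact le_iSup (fun n => F (s' n) ω) 0

/-- The essential supremum of an upward directed family of integrable random variables containing
`0`: it has a version measurable with respect to the `σ`-algebra of the family, and its integral is
bounded by any common bound of the integrals. -/
theorem exists_isEssSup_of_directed {Ω ι : Type*} {G m : MeasurableSpace Ω} (hG : G ≤ m)
    {P : Measure Ω} [IsFiniteMeasure P] {f : ι → Ω → ℝ}
    (hfm : ∀ i, AEStronglyMeasurable[G] (f i) P) (hfi : ∀ i, Integrable (f i) P) (i₀ : ι)
    (hi₀ : f i₀ =ᵐ[P] 0) (hdir : ∀ i j, ∃ k, ∀ᵐ ω ∂P, f k ω = max (f i ω) (f j ω)) :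
    ∃ c : Ω → ℝ≥0∞, Measurable[G] c ∧
      DynRisk.IsEssSup P (fun i ω => ((f i ω : ℝ) : EReal)) (fun ω => (c ω : EReal)) ∧
      ∀ α : ℝ, (∀ i, ∫ ω, f i ω ∂P ≤ α) → ∫⁻ ω, c ω ∂P ≤ ENNReal.ofReal α := by
  have : Nonempty ι := ⟨i₀⟩
  -- Truncation at `0` does not change the supremum, because the family contains `0`.
  let F : ι → Ω → ℝ≥0∞ := fun i ω => ENNReal.ofReal ((hfm i).mk (f i) ω)
  have hFm : ∀ i, Measurable[G] (F i) := fun i =>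
    (hfm i).stronglyMeasurable_mk.measurable.ennreal_ofReal
  have hFf : ∀ i, ∀ᵐ ω ∂P, F i ω = ENNReal.ofReal (f i ω) := fun i => by
    filter_upwards [(hfm i).ae_eq_mk] with ω h
    simp only [F, ← h]
  obtain ⟨s, hs⟩ := exists_seq_forall_ae_le_iSup fun i => ((hFm i).mono hG le_rfl).aemeasurable
    (μ := P)
  have hcm : Measurable[G] fun ω => ⨆ n, F (s n) ω := Measurable.iSup fun n => hFm (s n)
  refine ⟨fun ω => ⨆ n, F (s n) ω, hcm, ⟨?_, fun i => ?_, fun Z hZm hZ => ?_⟩, fun α hα => ?_⟩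
  · exact measurable_coe_ennreal_ereal.comp (hcm.mono hG le_rfl)
  · filter_upwards [hs i, hFf i] with ω h1 h2
    rw [h2] at h1
    calc ((f i ω : ℝ) : EReal) ≤ ((ENNReal.ofReal (f i ω) : ℝ≥0∞) : EReal) := by
          rw [EReal.coe_ennreal_ofReal]
          exact EReal.coe_le_coe_iff.2 (le_max_left _ _)
      _ ≤ _ := EReal.coe_ennreal_le_coe_ennreal_iff.2 h1
  · filter_upwards [hZ i₀, hi₀, ae_all_iff.2 fun n => hZ (s n), ae_all_iff.2 fun n => hFf (s n)]
      with ω h1 h2 h3 h4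
    have h0 : (0 : EReal) ≤ Z ω := by
      rw [h2] at h1
      exact h1
    have hle : ⨆ n, F (s n) ω ≤ (Z ω).toENNReal := by
      refine iSup_le fun n => ?_
      rw [h4 n, ← EReal.real_coe_toENNReal]
      exact EReal.toENNReal_le_toENNReal (h3 n)
    calc ((⨆ n, F (s n) ω : ℝ≥0∞) : EReal) ≤ ((Z ω).toENNReal : EReal) :=
          EReal.coe_ennreal_le_coe_ennreal_iff.2 hle
      _ = Z ω := EReal.coe_toENNReal h0
  · choose dir hdir using hdir
    -- Successive joins starting from `0` give an increasing sequence inside the family that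
    -- dominates the chosen one; monotone convergence then bounds the integral of the supremum.
    let k : ℕ → ι := fun n => Nat.rec i₀ (fun n i => dir i (s n)) n
    have hk : ∀ n, ∀ᵐ ω ∂P, f (k (n + 1)) ω = max (f (k n) ω) (f (s n) ω) := fun n =>
      hdir (k n) (s n)
    have hk0 : ∀ n, 0 ≤ᵐ[P] f (k n) := by
      intro n
      induction n with
      | zero => exact hi₀.symm.le
      | succ n ih =>
        filter_upwards [hk n, ih] with ω h1 h2
        rw [h1]
        exact h2.trans (le_max_left _ _)
    calc ∫⁻ ω, ⨆ n, F (s n) ω ∂P ≤ ∫⁻ ω, ⨆ n, F (k n) ω ∂P := by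
          refine lintegral_mono_ae ?_
          filter_upwards [ae_all_iff.2 hk, ae_all_iff.2 fun n => hFf (k n),
            ae_all_iff.2 fun n => hFf (s n)] with ω h1 h2 h3
          refine iSup_le fun n => le_trans ?_ (le_iSup (fun n => F (k n) ω) (n + 1))
          rw [h3 n, h2 (n + 1), h1 n]
          exact ENNReal.ofReal_le_ofReal (le_max_right _ _)
      _ = ⨆ n, ∫⁻ ω, F (k n) ω ∂P := by
          refine lintegral_iSup' (fun n => ((hFm (k n)).mono hG le_rfl).aemeasurable) ?_
          filter_upwards [ae_all_iff.2 hk, ae_all_iff.2 fun n => hFf (k n)] with ω h1 h2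
          refine monotone_nat_of_le_succ fun n => ?_
          rw [h2 n, h2 (n + 1), h1 n]
          exact ENNReal.ofReal_le_ofReal (le_max_left _ _)
      _ ≤ ENNReal.ofReal α := by
          refine iSup_le fun n => ?_
          rw [lintegral_congr_ae (hFf (k n)), ← ofReal_integral_eq_lintegral_ofReal (hfi _) (hk0 n)]
          exact ENNReal.ofReal_le_ofReal (hα _)

/-- Since only `Q ≪ P` is available in the application, a `Q`-null set need not be `P`-null; events
in `G` are the exception. Identities and limits of `Q`-conditional expectations reach `P` this way.
-/
theorem ae_of_ae_of_measure_eq {Ω : Type*} {G m : MeasurableSpace Ω} {P Q : Measure Ω}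
    (h : ∀ A, MeasurableSet[G] A → Q A = P A) {p : Ω → Prop} (hp : MeasurableSet[G] {ω | p ω})
    (hQ : ∀ᵐ ω ∂Q, p ω) : ∀ᵐ ω ∂P, p ω := by
  rw [ae_iff] at hQ ⊢
  exact (h _ hp.compl).symm.trans hQ

/-! ### The minimal penalty -/

namespace DynRisk

variable {Ω : Type*} {m : MeasurableSpace Ω} {P : Measure Ω} {τ : Type*} [Preorder τ]
  {ℱ : Filtration τ m} {t : τ}

theorem integrable_neg_coeFn (Q : measuresAt P ℱ t) [IsProbabilityMeasure P] (X : Lp ℝ ∞ P) :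
    Integrable (fun ω => -X ω) Q.1 := by
  have := isProbabilityMeasure_of_measure_eq Q.2.2
  exact ((memLp_top_of_absolutelyContinuous (Lp.memLp X) Q.2.1).integrable le_top).neg

theorem measurable_discountedCondExp (D : discountFactors ℱ) (Q : measuresAt P ℱ t)
    (X : Lp ℝ ∞ P) : Measurable[ℱ t] (discountedCondExp ℱ t D Q X) :=
  (D.2.1 t).mul stronglyMeasurable_condExp.measurable

theorem integrable_discountedCondExp [IsProbabilityMeasure P] (D : discountFactors ℱ)
    (Q : measuresAt P ℱ t) (X : Lp ℝ ∞ P) : Integrable (discountedCondExp ℱ t D Q X) P := by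
  have h1 : Integrable (Q.1[fun ω' => -X ω' | ℱ t]) P := by
    refine integrable_of_integrable_trim (ℱ.le t) ?_
    rw [← trim_eq_of_measure_eq (ℱ.le t) Q.2.2]
    exact integrable_condExp.trim (ℱ.le t) stronglyMeasurable_condExp
  refine h1.bdd_mul (c := 1) ((D.2.1 t).mono (ℱ.le t) le_rfl).aestronglyMeasurable
    (ae_of_all _ fun ω => ?_)
  rw [Real.norm_eq_abs, abs_of_nonneg (D.2.2 t ω).1]
  exact (D.2.2 t ω).2

theorem discountedCondExp_zero [IsProbabilityMeasure P] (D : discountFactors ℱ) (Q : measuresAt P ℱ t) (ω : Ω) :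
    discountedCondExp ℱ t D Q 0 ω = 0 := by
  have h : (fun ω => -(0 : Lp ℝ ∞ P) ω) = 0 := by
    ext ω
    simp
  simp only [discountedCondExp, h, condExp_zero, Pi.zero_apply, mul_zero]

/-- The class `X 1_A + Y 1_{Aᶜ}`. -/
theorem exists_paste (X Y : Lp ℝ ∞ P) {A : Set Ω} (hA : MeasurableSet A) :
    ∃ Z : Lp ℝ ∞ P, ∀ᵐ ω ∂P, Z ω = A.indicator X ω + Aᶜ.indicator Y ω := by
  have h := ((Lp.memLp X).indicator hA).add ((Lp.memLp Y).indicator hA.compl)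
  exact ⟨h.toLp _, h.coeFn_toLp⟩

/-- The counterpart of regularity for the linear term: conditional expectation is local on
`F_t`-events, and both sides are `F_t`-measurable, so the identity passes from `Q` to `P`. -/
theorem discountedCondExp_paste [IsProbabilityMeasure P] (D : discountFactors ℱ)
    (Q : measuresAt P ℱ t) {X Y Z : Lp ℝ ∞ P} {A : Set Ω} (hA : MeasurableSet[ℱ t] A)
    (hZ : ∀ᵐ ω ∂P, Z ω = A.indicator X ω + Aᶜ.indicator Y ω) :
    ∀ᵐ ω ∂P, discountedCondExp ℱ t D Q Z ω = A.indicator (discountedCondExp ℱ t D Q X) ω +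
      Aᶜ.indicator (discountedCondExp ℱ t D Q Y) ω := by
  have hX := integrable_neg_coeFn Q X
  have hY := integrable_neg_coeFn Q Y
  have h1 : (fun ω => -Z ω) =ᵐ[Q.1]
      A.indicator (fun ω => -X ω) + Aᶜ.indicator (fun ω => -Y ω) := by
    filter_upwards [Q.2.1.ae_le hZ] with ω h
    rw [h]
    by_cases hω : ω ∈ A <;> simp [hω]
  have h2 : Q.1[fun ω => -Z ω | ℱ t] =ᵐ[Q.1] A.indicator (Q.1[fun ω => -X ω | ℱ t]) +
      Aᶜ.indicator (Q.1[fun ω => -Y ω | ℱ t]) := by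
    refine (condExp_congr_ae h1).trans ((condExp_add (hX.indicator (ℱ.le t _ hA))
      (hY.indicator (ℱ.le t _ hA.compl)) _).trans ?_)
    exact (condExp_indicator hX hA).add (condExp_indicator hY hA.compl)
  have h3 := ae_of_ae_of_measure_eq Q.2.2 (p := fun ω => (Q.1[fun ω => -Z ω | ℱ t]) ω =
    (A.indicator (Q.1[fun ω => -X ω | ℱ t]) + Aᶜ.indicator (Q.1[fun ω => -Y ω | ℱ t])) ω)
    (measurableSet_eq_fun stronglyMeasurable_condExp.measurable
      ((stronglyMeasurable_condExp.measurable.indicator hA).add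
        (stronglyMeasurable_condExp.measurable.indicator hA.compl))) h2
  filter_upwards [h3] with ω h
  simp only [discountedCondExp]
  rw [h]
  by_cases hω : ω ∈ A <;> simp [hω, discountedCondExp]

variable {ρ : RiskFamily P ℱ}

theorem integrable_risk [IsFiniteMeasure P] (X : Lp ℝ ∞ P) :
    Integrable (ρ t X : Lp ℝ ∞ P) P := (Lp.memLp (ρ t X : Lp ℝ ∞ P)).integrable le_top

theorem aestronglyMeasurable_risk (X : Lp ℝ ∞ P) :
    AEStronglyMeasurable[ℱ t] (ρ t X : Lp ℝ ∞ P) P :=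
  mem_lpMeas_iff_aestronglyMeasurable.1 (ρ t X).2

/-- The minimal penalty exists, as an `F_t`-measurable random variable, and its expectation is
bounded by any common bound of the expectations of the family. -/
theorem exists_minimal_penalty [IsProbabilityMeasure P] (hnorm : IsNormalized ρ)
    (hreg : IsRegular ρ) (D : discountFactors ℱ) (Q : measuresAt P ℱ t) :
    ∃ c : Ω → ℝ≥0∞, Measurable[ℱ t] c ∧
      IsEssSup P (fun (X : Lp ℝ ∞ P) ω =>
        ((discountedCondExp ℱ t D Q X ω - (ρ t X : Lp ℝ ∞ P) ω : ℝ) : EReal))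
        (fun ω => (c ω : EReal)) ∧
      ∀ α : ℝ, (∀ X : Lp ℝ ∞ P, ∫ ω, discountedCondExp ℱ t D Q X ω ∂P -
        ∫ ω, (ρ t X : Lp ℝ ∞ P) ω ∂P ≤ α) → ∫⁻ ω, c ω ∂P ≤ ENNReal.ofReal α := by
  have hzero : (fun ω => discountedCondExp ℱ t D Q 0 ω - (ρ t 0 : Lp ℝ ∞ P) ω) =ᵐ[P] 0 :=
    ae_of_all _ fun ω => by simp [discountedCondExp_zero, hnorm t]
  have hdir : ∀ X Y : Lp ℝ ∞ P, ∃ Z : Lp ℝ ∞ P, ∀ᵐ ω ∂P,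
      discountedCondExp ℱ t D Q Z ω - (ρ t Z : Lp ℝ ∞ P) ω =
        max (discountedCondExp ℱ t D Q X ω - (ρ t X : Lp ℝ ∞ P) ω)
          (discountedCondExp ℱ t D Q Y ω - (ρ t Y : Lp ℝ ∞ P) ω) := by
    intro X Y
    have hX := aestronglyMeasurable_risk (ρ := ρ) (t := t) X
    have hY := aestronglyMeasurable_risk (ρ := ρ) (t := t) Y
    -- Pasting `X` and `Y` along the event where `X` does better realizes the maximum.
    -- `F_t`-measurable versions put this event in `F_t`.
    set A : Set Ω := {ω | discountedCondExp ℱ t D Q Y ω - hY.mk _ ω ≤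
      discountedCondExp ℱ t D Q X ω - hX.mk _ ω} with hAdef
    have hA : MeasurableSet[ℱ t] A := measurableSet_le
      ((measurable_discountedCondExp D Q Y).sub hY.stronglyMeasurable_mk.measurable)
      ((measurable_discountedCondExp D Q X).sub hX.stronglyMeasurable_mk.measurable)
    obtain ⟨Z, hZ⟩ := exists_paste X Y (ℱ.le t _ hA)
    refine ⟨Z, ?_⟩
    filter_upwards [hreg t A hA X Y Z hZ, discountedCondExp_paste D Q hA hZ, hX.ae_eq_mk,
      hY.ae_eq_mk] with ω h1 h2 h3 h4
    rw [h1, h2]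
    by_cases hω : ω ∈ A
    · have hω' := hω
      rw [hAdef, Set.mem_ofPred_eq, ← h3, ← h4] at hω'
      simp [hω, hω']
    · have hω' := hω
      rw [hAdef, Set.mem_ofPred_eq, ← h3, ← h4, not_le] at hω'
      simp [hω, hω'.le]
  obtain ⟨c, hc, hsup, hint⟩ := exists_isEssSup_of_directed (ℱ.le t) (P := P)
    (f := fun (X : Lp ℝ ∞ P) ω => discountedCondExp ℱ t D Q X ω - (ρ t X : Lp ℝ ∞ P) ω)
    (fun X => (measurable_discountedCondExp D Q X).aestronglyMeasurable.sub
      (aestronglyMeasurable_risk X))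
    (fun X => (integrable_discountedCondExp D Q X).sub (integrable_risk X)) 0 hzero hdir
  refine ⟨c, hc, hsup, fun α hα => hint α fun X => ?_⟩
  rw [integral_sub (integrable_discountedCondExp D Q X) (integrable_risk X)]
  exact hα X

end DynRisk

/-! ### From continuity from above to the representation -/

namespace DynRisk

variable {Ω : Type*} {m : MeasurableSpace Ω} {P : Measure Ω} {τ : Type*} [Preorder τ]
  {ℱ : Filtration τ m} {t : τ} {ρ : RiskFamily P ℱ}

theorem le_of_antitone_of_tendsto_ae {Xn : ℕ → Lp ℝ ∞ P} {X : Lp ℝ ∞ P} (hanti : Antitone Xn)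
    (hlim : ∀ᵐ ω ∂P, Tendsto (fun n => Xn n ω) atTop (𝓝 (X ω))) (n : ℕ) : X ≤ Xn n := by
  have hle : ∀ᵐ ω ∂P, ∀ k, n ≤ k → Xn k ω ≤ Xn n ω := by
    rw [ae_all_iff]
    intro k
    by_cases hk : n ≤ k
    · filter_upwards [Lp.coeFn_le _ _ |>.2 (hanti hk)] with ω h _ using h
    · exact ae_of_all _ fun ω h => (hk h).elim
  rw [← Lp.coeFn_le]
  filter_upwards [hle, hlim] with ω h1 h2
  exact le_of_tendsto h2 (by filter_upwards [eventually_ge_atTop n] with k hk using h1 k hk)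

theorem ae_abs_le_add_of_le_of_le {X Y Z : Lp ℝ ∞ P} (h1 : X ≤ Y) (h2 : Y ≤ Z) :
    ∀ᵐ ω ∂P, |Y ω| ≤ |X ω| + |Z ω| := by
  filter_upwards [(Lp.coeFn_le _ _).2 h1, (Lp.coeFn_le _ _).2 h2] with ω h1 h2
  rw [abs_le]
  constructor
  · linarith [neg_abs_le (X ω), abs_nonneg (Z ω)]
  · linarith [le_abs_self (Z ω), abs_nonneg (X ω)]

/-- Monotonicity traps `ρ_t(X_n)` between `ρ_t(X_0)` and `ρ_t(X)`, which supplies the dominating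
function. -/
theorem tendsto_integral_risk [IsFiniteMeasure P] (hmono : IsMonotone ρ)
    (hcont : ContinuousFromAbove fun X => (ρ t X : Lp ℝ ∞ P)) (Xn : ℕ → Lp ℝ ∞ P)
    (X : Lp ℝ ∞ P) (hanti : Antitone Xn)
    (hlim : ∀ᵐ ω ∂P, Tendsto (fun n => Xn n ω) atTop (𝓝 (X ω))) :
    Tendsto (fun n => ∫ ω, (ρ t (Xn n) : Lp ℝ ∞ P) ω ∂P) atTop
      (𝓝 (∫ ω, (ρ t X : Lp ℝ ∞ P) ω ∂P)) := by
  refine tendsto_integral_of_dominated_convergence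
    (fun ω => |(ρ t (Xn 0) : Lp ℝ ∞ P) ω| + |(ρ t X : Lp ℝ ∞ P) ω|)
    (fun n => Lp.aestronglyMeasurable _) ((integrable_risk _).abs.add (integrable_risk _).abs)
    (fun n => ?_) (hcont Xn X hanti hlim)
  exact ae_abs_le_add_of_le_of_le (hmono t _ _ (hanti (Nat.zero_le n)))
    (hmono t _ _ (le_of_antitone_of_tendsto_ae hanti hlim n))

theorem convexOn_integral_risk [IsFiniteMeasure P] (hconv : IsConvex ρ) :
    ConvexOn ℝ Set.univ fun X => ∫ ω, (ρ t X : Lp ℝ ∞ P) ω ∂P := by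
  refine ⟨convex_univ, fun X _ Y _ a b ha hb hab => ?_⟩
  obtain rfl : b = 1 - a := by linarith
  simp only [smul_eq_mul]
  rw [← integral_const_mul, ← integral_const_mul,
    ← integral_add ((integrable_risk X).const_mul _) ((integrable_risk Y).const_mul _)]
  refine integral_mono_ae (integrable_risk _)
    (((integrable_risk X).const_mul _).add ((integrable_risk Y).const_mul _)) ?_
  filter_upwards [(Lp.coeFn_le _ _).2 (hconv t X Y a ha (by linarith)),
    Lp.coeFn_add (a • (ρ t X : Lp ℝ ∞ P)) ((1 - a) • (ρ t Y : Lp ℝ ∞ P)),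
    Lp.coeFn_smul a (ρ t X : Lp ℝ ∞ P), Lp.coeFn_smul (1 - a) (ρ t Y : Lp ℝ ∞ P)]
    with ω h1 h2 h3 h4
  rw [h2, Pi.add_apply, h3, h4] at h1
  exact h1

/-- Cash-subadditivity bounds the conditional expectation of the density of an affine minorant. -/
theorem setIntegral_density_le [IsProbabilityMeasure P] (hcash : IsCashSubadditive ρ)
    (hnorm : IsNormalized ρ) {Y : Ω → ℝ} {α : ℝ}
    (hα : ∀ X : Lp ℝ ∞ P, -(∫ ω, Y ω * X ω ∂P) - ∫ ω, (ρ t X : Lp ℝ ∞ P) ω ∂P ≤ α)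
    {A : Set Ω} (hA : MeasurableSet[ℱ t] A) : ∫ ω in A, Y ω ∂P ≤ P.real A := by
  have hA' : MeasurableSet A := ℱ.le t _ hA
  -- Test the affine bound at `-c 1_A`: cash-subadditivity and normalization give `ρ_t(-c 1_A) ≤ c
  -- 1_A`. The bound is uniform in `c`, so the bracket cannot be positive.
  have hkey : ∀ c : ℝ, 0 ≤ c → c * (∫ ω in A, Y ω ∂P - P.real A) ≤ α := by
    intro c hc
    set M : Lp ℝ ∞ P := indicatorConstLp ∞ hA' (measure_ne_top P A) c with hM
    have hMcoe : M =ᵐ[P] A.indicator fun _ => c := indicatorConstLp_coeFn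
    have hMmem : M ∈ LInfty P ℱ t := mem_lpMeas_indicatorConstLp (ℱ.le t) hA (measure_ne_top P A)
    have hM0 : 0 ≤ M := by
      rw [← Lp.coeFn_nonneg]
      filter_upwards [hMcoe] with ω h
      rw [h]
      exact Set.indicator_nonneg (fun _ _ => hc) ω
    have h1 := hcash t (-M) ⟨M, hMmem⟩ hM0
    simp only [neg_add_cancel, hnorm t, ZeroMemClass.coe_zero, sub_nonpos] at h1
    have h2 : ∫ ω, (ρ t (-M) : Lp ℝ ∞ P) ω ∂P ≤ c * P.real A := by
      calc ∫ ω, (ρ t (-M) : Lp ℝ ∞ P) ω ∂P ≤ ∫ ω, A.indicator (fun _ => c) ω ∂P := by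
            refine integral_mono_ae (integrable_risk _)
              ((integrable_const c).indicator hA') ?_
            filter_upwards [(Lp.coeFn_le _ _).2 h1, hMcoe] with ω h h'
            rwa [← h']
        _ = c * P.real A := by rw [integral_indicator_const _ hA', smul_eq_mul, mul_comm]
    have h3 : -(∫ ω, Y ω * (-M : Lp ℝ ∞ P) ω ∂P) = c * ∫ ω in A, Y ω ∂P := by
      rw [← integral_neg, ← integral_const_mul, ← integral_indicator hA']
      refine integral_congr_ae ?_
      filter_upwards [Lp.coeFn_neg M, hMcoe] with ω h h'
      rw [h, Pi.neg_apply, h']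
      by_cases hω : ω ∈ A <;> simp [hω, mul_comm]
    have h4 := hα (-M)
    rw [h3] at h4
    linarith
  by_contra! hlt
  have hpos : 0 < ∫ ω in A, Y ω ∂P - P.real A := by linarith
  have h1 := hkey ((|α| + 1) / (∫ ω in A, Y ω ∂P - P.real A)) (by positivity)
  rw [div_mul_cancel₀ _ hpos.ne'] at h1
  linarith [le_abs_self α]

/-- Existence of nearly optimal scenarios for the expected risk. -/
theorem exists_near_optimal [IsProbabilityMeasure P] (hconv : IsConvex ρ) (hmono : IsMonotone ρ)
    (hcash : IsCashSubadditive ρ) (hnorm : IsNormalized ρ)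
    (hcont : ContinuousFromAbove fun X => (ρ t X : Lp ℝ ∞ P)) (X₀ : Lp ℝ ∞ P) {a : ℝ}
    (ha : a < ∫ ω, (ρ t X₀ : Lp ℝ ∞ P) ω ∂P) :
    ∃ (D : discountFactors ℱ) (Q : measuresAt P ℱ t), ∀ X : Lp ℝ ∞ P,
      ∫ ω, discountedCondExp ℱ t D Q X ω ∂P - ∫ ω, (ρ t X : Lp ℝ ∞ P) ω ∂P ≤
        ∫ ω, discountedCondExp ℱ t D Q X₀ ω ∂P - a := by
  classical
  obtain ⟨Y, hYi, hY0, hY⟩ := exists_affine_minorant (convexOn_integral_risk hconv)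
    (fun X Z hXZ => integral_mono_ae (integrable_risk _) (integrable_risk _)
      ((Lp.coeFn_le _ _).2 (hmono t X Z hXZ)))
    (tendsto_integral_risk hmono hcont) X₀ ha
  obtain ⟨D, hDm, hD, Q, hQP, hQ, hDQ⟩ := exists_discount_factor_measure (ℱ.le t) hYi hY0
    fun A hA => setIntegral_density_le hcash hnorm hY hA
  -- Only `D_t` enters the formula, so the process is set to `0` at all other times.
  refine ⟨⟨fun s ω => if s = t then D ω else 0, fun s => ?_, fun s ω => ?_⟩, ⟨Q, hQP, hQ⟩,
    fun X => ?_⟩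
  · by_cases h : s = t
    · subst h
      simpa using hDm
    · simp only [h, if_false]
      exact measurable_const
  · by_cases h : s = t
    · simpa [h] using hD ω
    · simp [h]
  · have hdisc : ∀ X : Lp ℝ ∞ P, ∫ ω, D ω * (Q[fun ω => -X ω | ℱ t]) ω ∂P =
        -∫ ω, Y ω * X ω ∂P := by
      intro X
      rw [hDQ (fun ω => -X ω) (Lp.memLp X).neg, ← integral_neg]
      exact integral_congr_ae (ae_of_all _ fun ω => by simp)
    simp only [discountedCondExp, if_true, hdisc]
    exact hY X

/-- Swaps penalty and risk in the Fenchel inequality; an infinite penalty makes both sides true. -/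
theorem coe_sub_coe_le_coe_iff {x y : ℝ} {c : ℝ≥0∞} :
    (x : EReal) - (c : EReal) ≤ (y : EReal) ↔ ((x - y : ℝ) : EReal) ≤ (c : EReal) := by
  induction c with
  | top => simp
  | coe c =>
    have h : ((c : ℝ≥0∞) : EReal) = ((c : ℝ) : EReal) := rfl
    rw [h, ← EReal.coe_sub, EReal.coe_le_coe_iff, EReal.coe_le_coe_iff]
    constructor <;> intro h <;> linarith

theorem le_toReal_of_coe_le_coe {x : ℝ} {c : ℝ≥0∞} (hc : c ≠ ∞)
    (h : (x : EReal) ≤ (c : EReal)) : x ≤ c.toReal := by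
  lift c to NNReal using hc
  exact EReal.coe_le_coe_iff.1 h

/-- Continuity from above gives the dual representation with the minimal penalty. -/
theorem exists_penalty_of_continuousFromAbove [IsProbabilityMeasure P] (hconv : IsConvex ρ)
    (hmono : IsMonotone ρ) (hcash : IsCashSubadditive ρ) (hnorm : IsNormalized ρ)
    (hreg : IsRegular ρ) (hcont : ContinuousFromAbove fun X => (ρ t X : Lp ℝ ∞ P)) :
    ∃ c : PenaltyMap P ℱ t, IsPenaltyTerm c ∧ IsMinimalPenalty ρ t c ∧ IsRepresentedBy ρ t c := by
  choose c hcm hcsup hcint using exists_minimal_penalty (P := P) (ℱ := ℱ) (t := t) hnorm hreg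
  refine ⟨c, hcm, hcsup, fun X₀ => ⟨?_, fun p => ?_, fun Z hZm hZ => ?_⟩⟩
  · exact measurable_coe_real_ereal.comp (Lp.stronglyMeasurable _).measurable
  · filter_upwards [(hcsup p.1 p.2).2.1 X₀] with ω h
    exact coe_sub_coe_le_coe_iff.2 h
  · set φ := ∫ ω, (ρ t X₀ : Lp ℝ ∞ P) ω ∂P with hφ
    choose D Q hDQ using fun n : ℕ => exists_near_optimal hconv hmono hcash hnorm hcont X₀
      (sub_lt_self φ (by positivity : (0 : ℝ) < 1 / ((n : ℝ) + 1)))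
    have hc : ∀ n, ∫⁻ ω, c (D n) (Q n) ω ∂P ≤ ENNReal.ofReal
        (∫ ω, discountedCondExp ℱ t (D n) (Q n) X₀ ω ∂P - (φ - 1 / ((n : ℝ) + 1))) :=
      fun n => hcint (D n) (Q n) _ (hDQ n)
    have hcm' : ∀ n, AEMeasurable (c (D n) (Q n)) P := fun n =>
      ((hcm (D n) (Q n)).mono (ℱ.le t) le_rfl).aemeasurable
    have hctop : ∀ n, ∀ᵐ ω ∂P, c (D n) (Q n) ω < ∞ := fun n =>
      ae_lt_top' (hcm' n) ((hc n).trans_lt ENNReal.ofReal_lt_top).ne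
    -- The duality gap of the `n`-th scenario at `X₀`: nonnegative by the Fenchel inequality, with
    -- expectation at most `1 / (n + 1)`.
    let g : ℕ → Ω → ℝ := fun n ω => (ρ t X₀ : Lp ℝ ∞ P) ω -
      (discountedCondExp ℱ t (D n) (Q n) X₀ ω - (c (D n) (Q n) ω).toReal)
    have hgi : ∀ n, ∫⁻ ω, ENNReal.ofReal (g n ω) ∂P ≤ ENNReal.ofReal (1 / ((n : ℝ) + 1)) := by
      intro n
      have hci : Integrable (fun ω => (c (D n) (Q n) ω).toReal) P :=
        integrable_toReal_of_lintegral_ne_top (hcm' n)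
          ((hc n).trans_lt ENNReal.ofReal_lt_top).ne
      have hdi := integrable_discountedCondExp (D n) (Q n) X₀
      have hg0 : 0 ≤ᵐ[P] g n := by
        filter_upwards [(hcsup (D n) (Q n)).2.1 X₀, hctop n] with ω h1 h2
        have h3 : discountedCondExp ℱ t (D n) (Q n) X₀ ω - (ρ t X₀ : Lp ℝ ∞ P) ω ≤
            (c (D n) (Q n) ω).toReal := le_toReal_of_coe_le_coe h2.ne h1
        simp only [g, Pi.zero_apply]
        linarith
      -- Testing near-optimality at `X = 0` shows that the bound is nonnegative, so `ENNReal.ofReal`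
      -- does not truncate it.
      have hα0 : 0 ≤ ∫ ω, discountedCondExp ℱ t (D n) (Q n) X₀ ω ∂P - (φ - 1 / ((n : ℝ) + 1)) := by
        have := hDQ n 0
        simpa [discountedCondExp_zero, hnorm t] using this
      have hcr : ∫ ω, (c (D n) (Q n) ω).toReal ∂P ≤
          ∫ ω, discountedCondExp ℱ t (D n) (Q n) X₀ ω ∂P - (φ - 1 / ((n : ℝ) + 1)) := by
        rw [integral_toReal (hcm' n) (hctop n)]
        exact ENNReal.toReal_le_of_le_ofReal hα0 (hc n)
      rw [← ofReal_integral_eq_lintegral_ofReal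
        (show Integrable (g n) P from (integrable_risk X₀).sub (hdi.sub hci)) hg0]
      refine ENNReal.ofReal_le_ofReal ?_
      have : ∫ ω, g n ω ∂P = φ - (∫ ω, discountedCondExp ℱ t (D n) (Q n) X₀ ω ∂P -
          ∫ ω, (c (D n) (Q n) ω).toReal ∂P) := by
        rw [← integral_sub hdi hci]
        exact integral_sub (integrable_risk X₀) (hdi.sub hci)
      rw [this]
      linarith
    have hinf : ∀ᵐ ω ∂P, ⨅ n, ENNReal.ofReal (g n ω) = 0 := by
      have hgm : ∀ n, AEMeasurable (fun ω => ENNReal.ofReal (g n ω)) P := fun n =>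
        ((Lp.stronglyMeasurable _).measurable.aemeasurable.sub
          (((measurable_discountedCondExp (D n) (Q n) X₀).mono (ℱ.le t) le_rfl).aemeasurable.sub
            (hcm' n).ennreal_toReal)).ennreal_ofReal
      refine (lintegral_eq_zero_iff' (AEMeasurable.iInf hgm)).1 (le_antisymm ?_ zero_le)
      have hlim : Tendsto (fun n : ℕ => ENNReal.ofReal (1 / ((n : ℝ) + 1))) atTop (𝓝 0) := by
        rw [← ENNReal.ofReal_zero]
        exact ENNReal.tendsto_ofReal tendsto_one_div_add_atTop_nhds_zero_nat
      exact ge_of_tendsto' hlim fun n =>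
        (lintegral_mono fun ω => iInf_le (fun n => ENNReal.ofReal (g n ω)) n).trans (hgi n)
    filter_upwards [hinf, ae_all_iff.2 hctop, ae_all_iff.2 fun n => hZ (D n, Q n)]
      with ω h1 h2 h3
    by_contra! hlt
    obtain ⟨r, hr1, hr2⟩ := EReal.lt_iff_exists_real_btwn.1 hlt
    rw [EReal.coe_lt_coe_iff] at hr2
    -- If a real `r` fit between the upper bound `Z` and `ρ_t(X₀)`, every gap would be at least
    -- `ρ_t(X₀) - r > 0`, against their zero infimum.
    have hle : ENNReal.ofReal ((ρ t X₀ : Lp ℝ ∞ P) ω - r) ≤ ⨅ n, ENNReal.ofReal (g n ω) := by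
      refine le_iInf fun n => ENNReal.ofReal_le_ofReal ?_
      have h4 := coe_sub_coe_le_coe_iff.1 ((h3 n).trans hr1.le)
      have h5 : discountedCondExp ℱ t (D n) (Q n) X₀ ω - r ≤ (c (D n) (Q n) ω).toReal :=
        le_toReal_of_coe_le_coe (h2 n).ne h4
      simp only [g]
      linarith
    rw [h1, nonpos_iff_eq_zero, ENNReal.ofReal_eq_zero] at hle
    linarith

end DynRisk

/-! ### From a representation to continuity from above -/

namespace DynRisk

variable {Ω : Type*} {m : MeasurableSpace Ω} {P : Measure Ω} {τ : Type*} [Preorder τ]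
  {ℱ : Filtration τ m} {t : τ} {ρ : RiskFamily P ℱ}

/-- Along a subsequence, discounted conditional expectations are continuous from above. -/
theorem exists_seq_tendsto_discountedCondExp [IsProbabilityMeasure P] (D : discountFactors ℱ)
    (Q : measuresAt P ℱ t) {Xn : ℕ → Lp ℝ ∞ P} {X : Lp ℝ ∞ P} (hanti : Antitone Xn)
    (hlim : ∀ᵐ ω ∂P, Tendsto (fun n => Xn n ω) atTop (𝓝 (X ω))) :
    ∃ ns : ℕ → ℕ, ∀ᵐ ω ∂P, Tendsto (fun k => discountedCondExp ℱ t D Q (Xn (ns k)) ω) atTop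
      (𝓝 (discountedCondExp ℱ t D Q X ω)) := by
  have := isProbabilityMeasure_of_measure_eq Q.2.2
  have hL1 : Tendsto (fun n => condExpL1 (ℱ.le t) Q.1 fun ω => -Xn n ω) atTop
      (𝓝 (condExpL1 (ℱ.le t) Q.1 fun ω => -X ω)) := by
    refine tendsto_condExpL1_of_dominated_convergence (ℱ.le t) (fun ω => |-X ω| + |-Xn 0 ω|)
      (fun n => (integrable_neg_coeFn Q (Xn n)).1)
      ((integrable_neg_coeFn Q X).abs.add (integrable_neg_coeFn Q (Xn 0)).abs) (fun n => ?_) ?_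
    · have h := ae_abs_le_add_of_le_of_le (le_of_antitone_of_tendsto_ae hanti hlim n)
        (hanti (Nat.zero_le n))
      filter_upwards [Q.2.1.ae_le h] with ω hω
      simpa using hω
    · filter_upwards [Q.2.1.ae_le hlim] with ω hω using hω.neg
  -- Convergence in `L¹(Q)` gives a.s. convergence along a subsequence, which is enough because the
  -- values are later compared with a supremum over all `n`.
  obtain ⟨ns, -, hns⟩ := (tendstoInMeasure_of_tendsto_Lp hL1).exists_seq_tendsto_ae
  refine ⟨ns, ?_⟩
  have hQ : ∀ᵐ ω ∂Q.1, Tendsto (fun k => (Q.1[fun ω => -Xn (ns k) ω | ℱ t]) ω) atTop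
      (𝓝 ((Q.1[fun ω => -X ω | ℱ t]) ω)) := by
    filter_upwards [hns, condExp_ae_eq_condExpL1 (μ := Q.1) (ℱ.le t) (fun ω => -X ω),
      ae_all_iff.2 fun k => condExp_ae_eq_condExpL1 (μ := Q.1) (ℱ.le t) (fun ω => -Xn (ns k) ω)]
      with ω h1 h2 h3
    simpa only [h2, h3] using h1
  have hP := ae_of_ae_of_measure_eq Q.2.2 (@measurableSet_tendsto_fun _ _ _ (ℱ t) _ _ _ _ _ _ _ _ _
    (fun k => stronglyMeasurable_condExp.measurable) _ stronglyMeasurable_condExp.measurable) hQ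
  filter_upwards [hP] with ω hω using hω.const_mul _

/-- A dual representation implies continuity from above. -/
theorem IsRepresentedBy.continuousFromAbove [IsProbabilityMeasure P] (hmono : IsMonotone ρ)
    {c : PenaltyMap P ℱ t} (hc : IsRepresentedBy ρ t c) :
    ContinuousFromAbove fun X => (ρ t X : Lp ℝ ∞ P) := by
  intro Xn X hanti hlim
  have hle : ∀ n, (ρ t (Xn n) : Lp ℝ ∞ P) ≤ (ρ t X : Lp ℝ ∞ P) := fun n =>
    hmono t _ _ (le_of_antitone_of_tendsto_ae hanti hlim n)
  -- The supremum of the risks is a measurable upper bound of the family at `X`; minimality of the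
  -- essential supremum does the rest.
  have hsup : ∀ᵐ ω ∂P, (((ρ t X : Lp ℝ ∞ P) ω : ℝ) : EReal) ≤
      ⨆ n, (((ρ t (Xn n) : Lp ℝ ∞ P) ω : ℝ) : EReal) := by
    refine (hc X).2.2 _ (Measurable.iSup fun n => (hc (Xn n)).1) fun p => ?_
    obtain ⟨ns, hns⟩ := exists_seq_tendsto_discountedCondExp p.1 p.2 hanti hlim
    filter_upwards [hns, ae_all_iff.2 fun n => (hc (Xn n)).2.1 p] with ω h1 h2
    have h3 : ∀ k, ((discountedCondExp ℱ t p.1 p.2 (Xn (ns k)) ω : ℝ) : EReal) -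
        (c p.1 p.2 ω : EReal) ≤ ⨆ n, (((ρ t (Xn n) : Lp ℝ ∞ P) ω : ℝ) : EReal) := fun k =>
      (h2 (ns k)).trans (le_iSup (fun n => (((ρ t (Xn n) : Lp ℝ ∞ P) ω : ℝ) : EReal)) (ns k))
    generalize c p.1 p.2 ω = a at h3 ⊢
    induction a with
    | top => simp
    | coe a =>
      have ha : ((a : ℝ≥0∞) : EReal) = ((a : ℝ) : EReal) := rfl
      simp only [ha, ← EReal.coe_sub] at h3 ⊢
      exact le_of_tendsto' ((continuous_coe_real_ereal.tendsto _).comp (h1.sub_const _)) h3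
  have hmon : ∀ᵐ ω ∂P, Monotone fun n => (ρ t (Xn n) : Lp ℝ ∞ P) ω := by
    have : ∀ᵐ ω ∂P, ∀ n, (ρ t (Xn n) : Lp ℝ ∞ P) ω ≤ (ρ t (Xn (n + 1)) : Lp ℝ ∞ P) ω :=
      ae_all_iff.2 fun n => (Lp.coeFn_le _ _).2 (hmono t _ _ (hanti n.le_succ))
    filter_upwards [this] with ω h using monotone_nat_of_le_succ h
  filter_upwards [hsup, hmon, ae_all_iff.2 fun n => (Lp.coeFn_le _ _).2 (hle n)] with ω h1 h2 h3
  rw [tendsto_order]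
  refine ⟨fun b hb => ?_, fun b hb => Eventually.of_forall fun n => (h3 n).trans_lt hb⟩
  obtain ⟨n, hn⟩ := lt_iSup_iff.1 ((EReal.coe_lt_coe_iff.2 hb).trans_le h1)
  filter_upwards [eventually_ge_atTop n] with k hk
  exact (EReal.coe_lt_coe_iff.1 hn).trans_le (h2 hk)

end DynRisk

theorem proposition3p5 {Ω : Type*} {m : MeasurableSpace Ω} (P : Measure Ω) [IsProbabilityMeasure P]
    {τ : Type*} [LinearOrder τ] [BoundedOrder τ] (ℱ : Filtration τ m)
    (hℱ_bot : ℱ ⊥ = ⊥) (hℱ_top : ℱ ⊤ = m)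
    (ρ : DynRisk.RiskFamily P ℱ)
    (hconv : DynRisk.IsConvex ρ) (hmono : DynRisk.IsMonotone ρ)
    (hcash : DynRisk.IsCashSubadditive ρ) (hnorm : DynRisk.IsNormalized ρ)
    (hreg : DynRisk.IsRegular ρ) :
    List.TFAE [
      ∀ t : τ, DynRisk.ContinuousFromAbove (fun X => (ρ t X : Lp ℝ ∞ P)),
      ∀ t : τ, ∃ c : DynRisk.PenaltyMap P ℱ t,
        DynRisk.IsPenaltyTerm c ∧ DynRisk.IsRepresentedBy ρ t c,
      ∀ t : τ, ∃ c : DynRisk.PenaltyMap P ℱ t,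
        DynRisk.IsPenaltyTerm c ∧ DynRisk.IsMinimalPenalty ρ t c ∧
          DynRisk.IsRepresentedBy ρ t c] := by
  tfae_have 1 → 3 := fun h t =>
    DynRisk.exists_penalty_of_continuousFromAbove hconv hmono hcash hnorm hreg (h t)
  tfae_have 3 → 2 := fun h t => by
    obtain ⟨c, hc, -, hrep⟩ := h t
    exact ⟨c, hc, hrep⟩
  tfae_have 2 → 1 := fun h t => by
    obtain ⟨c, -, hrep⟩ := h t
    exact hrep.continuousFromAbove hmono
  tfae_finish
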